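/- Let $\mu$ be the Möbius function and, for $k\ge 1$, let $\mu_k=\mu*\cdots*\mu$ ($k$ factors, Dirichlet convolution). For real $X$ and $\alpha$ put $S_{\mu_k}(X,\alpha)=\sum_{1\le n\le X}\mu_k(n)e(n\alpha)$, where $e(x)=\exp(2\pi i x)$. Define sequences by $$a_1=\tfrac45,\quad a_{m+1}=\frac{4-a_m}{5-2a_m};\qquad b_1=\tfrac12,\quad b_{m+1}=\frac{b_m}{3};\qquad c_1=\tfrac12,\quad c_{m+1}=\frac{4-c_m}{5-2c_m}\qquad(m\ge 1).$$ Let $\alpha\in\mathbb R$ and let $a/q$ be a reduced fraction ($a\in\mathbb Z$, $q\ge 1$, $\gcd(a,q)=1$) with $|\alpha-a/q|\le 1/q^2$. Then for every $X\ge 2$, every integer $k\ge 2$ and every fixed $\varepsilon>0$, $$|S_{\mu_k}(X,\alpha)|\le C\left(X^{a_k+\varepsilon}+\frac{X(\log X)^{k^2}}{q^{b_k}}+X^{c_k}q^{1-c_k}(\log X)^{k^2}\right),$$ where $C>0$ depends at most on $\varepsilon$ and $k$; if $X\ge 3$, then $C$ can be chosen to depend on $\varepsilon$ only (uniformly in $k$).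 Moreover, for $k=2$, every $X\ge 2$ and every fixed $\varepsilon>0$, $$|S_{\mu_2}(X,\alpha)|\le C'\left(X^{16/17+\varepsilon}+\left(\frac{X}{q^{1/6}}+X^{7/8}q^{1/8}\right)(\log X)^{3}\right),$$ where $C'>0$ depends only on $\varepsilon$. -/

import Mathlib

noncomputable section

/-- The `k`-fold Möbius convolution `μ_k = μ * ⋯ * μ` (`k` factors).  Multiplication, and hence
the power, in `ArithmeticFunction ℤ` is Dirichlet convolution. -/
def moebiusConv (k : ℕ) : ArithmeticFunction ℤ := ArithmeticFunction.moebius ^ k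

/-- `e(x) = exp(2πix)`. -/
def expChar (x : ℝ) : ℂ := Complex.exp (2 * (Real.pi : ℂ) * Complex.I * (x : ℂ))

/-- `S_{μ_k}(X, α) = ∑_{1 ≤ n ≤ X} μ_k(n) e(nα)`. -/
def moebiusExpSum (k : ℕ) (X α : ℝ) : ℂ :=
  ∑ n ∈ Finset.Icc 1 ⌊X⌋₊, (moebiusConv k n : ℂ) * expChar ((n : ℝ) * α)

/-- The sequence `a_1 = 4/5`, `a_{m+1} = (4 - a_m)/(5 - 2 a_m)`; index `0` is not used. -/
def seqA : ℕ → ℝ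
  | 0 => 0
  | 1 => 4 / 5
  | m + 2 => (4 - seqA (m + 1)) / (5 - 2 * seqA (m + 1))

/-- The sequence `b_1 = 1/2`, `b_{m+1} = b_m / 3`; index `0` is not used. -/
def seqB : ℕ → ℝ
  | 0 => 0
  | 1 => 1 / 2
  | m + 2 => seqB (m + 1) / 3

/-- The sequence `c_1 = 1/2`, `c_{m+1} = (4 - c_m)/(5 - 2 c_m)`; index `0` is not used. -/
def seqC : ℕ → ℝ
  | 0 => 0
  | 1 => 1 / 2
  | m + 2 => (4 - seqC (m + 1)) / (5 - 2 * seqC (m + 1))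

end

/-!
The proof bounds `S = ∑ μ_k(n) e(nα)` directly, with one decomposition of `μ_k` that serves all
`k ≥ 2`, rather than by induction on `k`.

Cut the Möbius function at `U`, as `μ = f + g` with `f` supported on `n ≤ U` and `g` on `n > U`.
Expanding `f ^ k` and `f ^ (k + 1) * 1` by the binomial theorem, and using `μ * 1 = δ`, both are
combinations of `μ ^ k` and `μ ^ (k - 1) * g` modulo `g ^ 2`.  Eliminating the latter gives
`μ ^ k = (k + 1) f ^ k - k (f ^ (k + 1) * 1) + g * (g * H)`, with `g * H` bounded by a multiple of
the `(k + 1)`-fold divisor function (`exists_moebius_pow_decomposition`).  The three parts are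

* a sum over `n ≤ U ^ k`, which is bounded trivially;
* a sum with one smooth variable and the other one at most `U ^ (k + 1)`
  (`norm_sum_mul_divisorFun_one_sq_le`);
* a bilinear sum with both variables larger than `U` (`norm_bilinear_sq_le`).

The last two rest on the spacing modulo one of the points `α n` with `n` in an interval of length `q`
(`sum_geomKernel_range_le`).  Together, with `l = 1 + log X`, they give
`S ^ 2 ≪ l ^ ((k + 1) ^ 2 + 2) X (X / q + q + X / U + U ^ (k + 1))`
(`norm_moebiusExpSum_sq_le`), and `U ≍ X ^ (2 (1 - a_k))` makes the last two terms at most a multiple of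
`X ^ (2 a_k - 1)`.

The savings `q ^ (-1/2)` and `(q / X) ^ (1/2)` are larger than the `q ^ (-b_k)` and
`(q / X) ^ (1 - c_k)` that are required.  For `k ≥ 3` the power of the logarithm is already at most
`k ^ 2`.  For `k = 2` it is `11 / 2`, and interpolation with the trivial bound `S ≤ X l` trades the
surplus saving for a power at most `3` (`le_mul_rpow_of_sq_le`).

Uniformity in `k` costs nothing more: only boundedly many `k` have `a_k + ε < 1 + ε / 2`, and for
large `k` the trivial bound `X l ^ (k - 1)` suffices (`exists_uniform_of_large`).
-/

noncomputable section

open Finset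

/-! ### Geometric sums -/

lemma norm_expChar (x : ℝ) : ‖expChar x‖ = 1 := by
  rw [expChar, show 2 * (Real.pi : ℂ) * Complex.I * (x : ℂ) = ((2 * Real.pi * x : ℝ) : ℂ) * Complex.I by
    push_cast; ring, Complex.norm_exp_ofReal_mul_I]

lemma expChar_nat_mul (n : ℕ) (x : ℝ) : expChar (n * x) = expChar x ^ n := by
  simp only [expChar, ← Complex.exp_nat_mul]
  push_cast
  ring_nf

lemma expChar_sub (x y : ℝ) : expChar (x - y) = expChar x * (starRingEnd ℂ) (expChar y) := by
  simp only [expChar, ← Complex.exp_conj, ← Complex.exp_add]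
  simp only [map_mul, Complex.conj_ofReal, Complex.conj_I, map_ofNat]
  push_cast
  ring_nf

/-- Jordan's inequality `|sin (π x)| ≥ 2‖x‖`, in terms of the distance `‖x‖` of `x` to `ℤ`. -/
lemma two_mul_norm_le_abs_sin (x : ℝ) :
    2 * ‖(x : UnitAddCircle)‖ ≤ |Real.sin (Real.pi * x)| := by
  -- both sides have period `1`, so `x` may be reduced to `[-1/2, 1/2]`
  have hper : |Real.sin (Real.pi * x)| = |Real.sin (Real.pi * (x - round x))| := by
    rw [show Real.pi * (x - round x) = Real.pi * x - (round x : ℤ) * Real.pi by ring,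
      Real.sin_sub_int_mul_pi, abs_mul, abs_zpow]
    simp
  have h0 := abs_sub_round x
  rw [hper, UnitAddCircle.norm_eq]
  set t := x - round x
  have h1 : |Real.sin (Real.pi * t)| = |Real.sin (Real.pi * |t|)| := by
    rcases abs_cases t with ⟨h, _⟩ | ⟨h, _⟩ <;> rw [h]
    simp
  have h2 := Real.mul_le_sin (x := Real.pi * |t|) (by positivity)
    (by nlinarith [Real.pi_pos])
  rw [h1]
  refine le_trans (le_of_eq ?_) (h2.trans (le_abs_self _))
  field_simp

/-- The usual majorant `min (M, 1/‖β‖)` of a geometric sum of length at most `M`, where `‖β‖` is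
the distance of `β` to the nearest integer.  Written as `(max (1/M) ‖β‖)⁻¹` it takes the value `M`
at integers `β`. -/
def geomKernel (M β : ℝ) : ℝ := (max M⁻¹ ‖(β : UnitAddCircle)‖)⁻¹

lemma geomKernel_nonneg {M : ℝ} (hM : 0 ≤ M) (β : ℝ) : 0 ≤ geomKernel M β :=
  inv_nonneg.2 (le_max_of_le_left (inv_nonneg.2 hM))

lemma geomKernel_le {M : ℝ} (hM : 0 < M) (β : ℝ) : geomKernel M β ≤ M := by
  rw [geomKernel]
  exact inv_le_of_inv_le₀ hM (le_max_left _ _)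

lemma geomKernel_le_inv {M β t : ℝ} (ht : 0 < t) (h : t ≤ ‖(β : UnitAddCircle)‖) :
    geomKernel M β ≤ t⁻¹ := by
  rw [geomKernel]
  exact inv_anti₀ ht (h.trans (le_max_right _ _))

lemma geomKernel_mono {M N : ℝ} (hM : 0 < M) (h : M ≤ N) (β : ℝ) :
    geomKernel M β ≤ geomKernel N β := by
  rw [geomKernel, geomKernel]
  exact inv_anti₀ (lt_max_of_lt_left (inv_pos.2 (hM.trans_le h)))
    (max_le_max_right _ (inv_anti₀ hM h))

lemma geomKernel_neg (M β : ℝ) : geomKernel M (-β) = geomKernel M β := by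
  rw [geomKernel, geomKernel, AddCircle.coe_neg, norm_neg]

lemma norm_sum_expChar_le {A B : ℕ} {M : ℝ} (hM : 0 < M) (hAB : A ≤ B) (h : (B : ℝ) - A ≤ M)
    (β : ℝ) : ‖∑ m ∈ Ico A B, expChar (m * β)‖ ≤ geomKernel M β := by
  set S := ∑ m ∈ Ico A B, expChar (m * β) with hS
  have h1 : ‖S‖ ≤ M := by
    refine (norm_sum_le _ _).trans ?_
    simp only [norm_expChar, sum_const, Nat.card_Ico, nsmul_eq_mul, mul_one]
    rwa [Nat.cast_sub hAB]
  -- telescoping: `|S| |e(β) - 1| ≤ 2`, while `|e(β) - 1| = 2 |sin (π β)| ≥ 4 ‖β‖`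
  have h2 : ‖S‖ * ‖(β : UnitAddCircle)‖ ≤ 1 := by
    have hgeom : S * (expChar β - 1) = expChar β ^ B - expChar β ^ A := by
      rw [hS, ← geom_sum_Ico_mul _ hAB]
      simp only [expChar_nat_mul]
    have hnorm : ‖expChar β - 1‖ = 2 * |Real.sin (Real.pi * β)| := by
      have := Complex.norm_exp_I_mul_ofReal_sub_one (2 * Real.pi * β)
      rw [expChar, show 2 * (Real.pi : ℂ) * Complex.I * (β : ℂ)
        = Complex.I * ((2 * Real.pi * β : ℝ) : ℂ) by push_cast; ring, this, norm_mul,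
        show 2 * Real.pi * β / 2 = Real.pi * β by ring]
      simp
    have h3 : ‖S‖ * ‖expChar β - 1‖ ≤ 2 := by
      rw [← norm_mul, hgeom]
      refine (norm_sub_le _ _).trans ?_
      simp only [norm_pow, norm_expChar, one_pow]
      norm_num
    have h4 := two_mul_norm_le_abs_sin β
    rw [hnorm] at h3
    nlinarith [norm_nonneg S, norm_nonneg (β : UnitAddCircle)]
  rw [geomKernel]
  have hpos : 0 < max M⁻¹ ‖(β : UnitAddCircle)‖ := lt_max_of_lt_left (inv_pos.2 hM)
  rw [← one_div, le_div_iff₀ hpos, mul_max_of_nonneg _ _ (norm_nonneg _)]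
  refine max_le ?_ h2
  rw [← div_eq_mul_inv, div_le_one hM]
  exact h1

/-! ### The geometric kernel over arithmetic progressions -/

lemma sum_Ioc_inv_le (n : ℕ) : ∑ i ∈ Ioc 0 n, (1 : ℝ) / i ≤ 1 + Real.log n := by
  have := harmonic_le_one_add_log n
  rw [harmonic_eq_sum_Icc] at this
  push_cast at this
  simpa [one_div] using! this

/-- Modulo one, the point `n / q` is as far from `0` as the residue of `n` modulo `q` allows. -/
lemma norm_intCast_div (q : ℕ) (hq : 0 < q) (n : ℤ) :
    ‖(((n : ℝ) / q : ℝ) : UnitAddCircle)‖ =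
      min ((n % q).toNat : ℝ) ((q : ℝ) - (n % q).toNat) / q := by
  set s := (n % q).toNat with hs
  have hs0 : ((s : ℕ) : ℤ) = n % q := Int.toNat_of_nonneg (Int.emod_nonneg _ (by positivity))
  have hsq : s < q := by
    have := Int.emod_lt_of_pos n (b := (q : ℤ)) (by positivity)
    omega
  have hq' : (q : ℝ) ≠ 0 := by positivity
  have h1 : ((n : ℝ) / q : ℝ) = (s : ℝ) / q + ((n / q : ℤ) : ℝ) := by
    have : (n : ℝ) = s + q * ((n / q : ℤ) : ℝ) := by
      have h := Int.emod_add_mul_ediv n q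
      rw [← hs0] at h
      exact_mod_cast h.symm
    rw [this]
    field_simp
  have h2 : ((((n / q : ℤ) : ℝ)) : UnitAddCircle) = 0 := by
    rw [AddCircle.coe_eq_zero_iff]
    exact ⟨n / q, by simp⟩
  rw [h1, AddCircle.coe_add, h2, add_zero]
  have := AddCircle.norm_div_natCast (p := (1 : ℝ)) (m := s) (n := q)
  rw [mul_one, one_mul, Nat.mod_eq_of_lt hsq, Nat.cast_min, Nat.cast_sub hsq.le] at this
  exact this

/-- If `a` is prime to `q`, then `c + a r` runs through distinct residues modulo `q` as `r` runs
through `0, …, q - 1`. -/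
lemma sum_residues_le (q : ℕ) (hq : 0 < q) (a c : ℤ) (ha : IsCoprime a (q : ℤ)) (G : ℕ → ℝ)
    (hG : ∀ s, 0 ≤ G s) :
    ∑ r ∈ range q, G ((c + a * r) % q).toNat ≤ ∑ s ∈ range q, G s := by
  have hq0 : (0 : ℤ) < q := by exact_mod_cast hq
  have hinj : Set.InjOn (fun r : ℕ => ((c + a * r) % (q : ℤ)).toNat) (range q) := by
    intro r hr r' hr' h
    simp only [coe_range, Set.mem_Iio] at hr hr'
    have h' : (c + a * r) % (q : ℤ) = (c + a * r') % q := by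
      have h1 := Int.emod_nonneg (c + a * r) hq0.ne'
      have h2 := Int.emod_nonneg (c + a * r') hq0.ne'
      simp only at h
      omega
    have h3 : (q : ℤ) ∣ (c + a * r') - (c + a * r) := (Int.ModEq.dvd h')
    have h4 : (q : ℤ) ∣ a * ((r' : ℤ) - r) := by
      convert h3 using 1; ring
    have h5 : (q : ℤ) ∣ (r' : ℤ) - r := ha.symm.dvd_of_dvd_mul_left h4
    have h6 : |(r' : ℤ) - r| < q := by rw [abs_lt]; omega
    have := Int.eq_zero_of_abs_lt_dvd h5 h6
    omega
  rw [← sum_image (f := G) hinj]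
  refine sum_le_sum_of_subset_of_nonneg ?_ (fun s _ _ => hG s)
  intro s hs
  simp only [mem_image, mem_range] at hs ⊢
  obtain ⟨r, _, rfl⟩ := hs
  have h1 := Int.emod_nonneg (c + a * r) hq0.ne'
  have h2 := Int.emod_lt_of_pos (c + a * r) hq0
  omega

/-- The points `β + α r` with `0 ≤ r < q` are within `2 / q` of fractions with denominator `q`. -/
lemma norm_intCast_div_le {α : ℝ} {a : ℤ} {q : ℕ} (hq : 0 < q)
    (hα : |α - a / q| ≤ 1 / (q : ℝ) ^ 2) (β : ℝ) {r : ℕ} (hr : r < q) :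
    ‖((((⌊q * β⌋ + a * r : ℤ) : ℝ) / q : ℝ) : UnitAddCircle)‖ ≤
      ‖((β + α * r : ℝ) : UnitAddCircle)‖ + 2 / q := by
  have hq' : (0 : ℝ) < q := by exact_mod_cast hq
  set c : ℤ := ⌊q * β⌋ with hc
  set n : ℤ := c + a * r with hn
  have e : ((n : ℝ) / q : ℝ) = (β + α * r) + ((n : ℝ) / q - (β + α * r)) := by ring
  rw [e, AddCircle.coe_add]
  refine (norm_add_le _ _).trans ?_
  gcongr
  have e1 : ‖(((n : ℝ) / q - (β + α * r) : ℝ) : UnitAddCircle)‖ ≤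
      |(n : ℝ) / q - (β + α * r)| := by
    rw [UnitAddCircle.norm_eq]
    simpa using round_le ((n : ℝ) / q - (β + α * r)) 0
  refine e1.trans ?_
  have e2 : (n : ℝ) / q - (β + α * r) = -((q * β - c) / q + r * (α - a / q)) := by
    rw [hn]; push_cast; field_simp; ring
  have h5 : |(q * β - c) / q| ≤ 1 / q := by
    rw [abs_div, abs_of_pos hq', abs_of_nonneg (by linarith [Int.floor_le (q * β)])]
    gcongr
    linarith [Int.lt_floor_add_one (q * β)]
  have h6 : |(r : ℝ) * (α - a / q)| ≤ 1 / q := by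
    rw [abs_mul, Nat.abs_cast]
    have hr' : (r : ℝ) ≤ q := by exact_mod_cast hr.le
    calc (r : ℝ) * |α - a / q| ≤ q * (1 / (q : ℝ) ^ 2) := by gcongr
      _ = 1 / q := by field_simp
  rw [e2, abs_neg]
  refine (abs_add_le _ _).trans (le_of_le_of_eq (add_le_add h5 h6) (by ring))

/-- A majorant for `geomKernel M` at a point within `2 / q` of `s / q`, as a function of the residue
`s`, when `s / q` is closer to `0` than to `1`.  The point may be arbitrarily close to `0` if `s` is
`0`, `1` or `2`: these residues get the value `M`. -/
def residueMajorant (M : ℝ) (q s : ℕ) : ℝ := if s < 3 then M else 3 * q / s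

lemma residueMajorant_nonneg {M : ℝ} (hM : 0 < M) (q s : ℕ) : 0 ≤ residueMajorant M q s := by
  rw [residueMajorant]; split_ifs <;> positivity

lemma sum_residueMajorant_le {M : ℝ} (hM : 0 < M) (q : ℕ) :
    ∑ s ∈ Ioc 0 q, residueMajorant M q s ≤ 3 * M + 3 * q * (1 + Real.log q) := by
  have hle : ∀ s ∈ Ioc 0 q,
      residueMajorant M q s ≤ (if s < 3 then M else 0) + 3 * q * (1 / s) := by
    intro s _
    rw [residueMajorant]
    split_ifs
    · have : 0 ≤ 3 * (q : ℝ) * (1 / s) := by positivity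
      linarith
    · rw [zero_add, mul_one_div]
  refine (sum_le_sum hle).trans ?_
  rw [sum_add_distrib, ← mul_sum]
  refine add_le_add ?_ (mul_le_mul_of_nonneg_left (sum_Ioc_inv_le q) (by positivity))
  rw [← sum_filter, sum_const, nsmul_eq_mul]
  gcongr
  have : #{s ∈ Ioc 0 q | s < 3} ≤ #(range 3) := card_le_card (by
    intro s; simp only [mem_filter, mem_range]; tauto)
  rw [card_range] at this
  exact_mod_cast this

lemma geomKernel_le_residueMajorant {α : ℝ} {a : ℤ} {q : ℕ} (hq : 0 < q)
    (hα : |α - a / q| ≤ 1 / (q : ℝ) ^ 2) {M : ℝ} (hM : 0 < M) (β : ℝ) {r : ℕ} (hr : r < q) :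
    geomKernel M (β + α * r) ≤ residueMajorant M q ((⌊q * β⌋ + a * r) % q).toNat +
      residueMajorant M q (q - ((⌊q * β⌋ + a * r) % q).toNat) := by
  have hq' : (0 : ℝ) < q := by exact_mod_cast hq
  have hd := norm_intCast_div_le hq hα β hr
  rw [norm_intCast_div q hq] at hd
  have hsq : ((⌊q * β⌋ + a * r) % q).toNat < q := by
    have := Int.emod_lt_of_pos (⌊q * β⌋ + a * r) (b := (q : ℤ)) (by positivity)
    omega
  generalize ((⌊q * β⌋ + a * r) % q).toNat = s at hd hsq ⊢
  by_cases h3 : s < 3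
  · refine (geomKernel_le hM _).trans ?_
    have := residueMajorant_nonneg hM q (q - s)
    have h4 : residueMajorant M q s = M := if_pos h3
    linarith
  by_cases h3' : q - s < 3
  · refine (geomKernel_le hM _).trans ?_
    have := residueMajorant_nonneg hM q s
    have h4 : residueMajorant M q (q - s) = M := if_pos h3'
    linarith
  have hsr : (3 : ℝ) ≤ s := by exact_mod_cast not_lt.1 h3
  have hsr' : (3 : ℝ) ≤ (q : ℝ) - s := by
    have : 3 ≤ q - s := not_lt.1 h3'
    have : 3 + s ≤ q := by omega
    have : ((3 + s : ℕ) : ℝ) ≤ q := by exact_mod_cast this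
    push_cast at this; linarith
  have hhs : residueMajorant M q s = 3 * q / s := if_neg h3
  have hhs' : residueMajorant M q (q - s) = 3 * q / ((q : ℝ) - s) := by
    rw [residueMajorant, if_neg h3', Nat.cast_sub hsq.le]
  rw [hhs, hhs']
  have aux : ∀ t : ℝ, 3 ≤ t → t / q ≤ ‖((β + α * r : ℝ) : UnitAddCircle)‖ + 2 / q →
      geomKernel M (β + α * r) ≤ 3 * q / t := by
    intro t ht htn
    have h1 : t / (3 * q) ≤ ‖((β + α * r : ℝ) : UnitAddCircle)‖ := by
      have : t / (3 * q) ≤ t / q - 2 / q := by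
        rw [div_sub_div_same, div_le_div_iff₀ (by positivity) hq']; nlinarith
      linarith
    refine (geomKernel_le_inv (by positivity) h1).trans ?_
    rw [inv_div]
  have hp : 0 ≤ 3 * (q : ℝ) / s := by positivity
  have hp' : 0 ≤ 3 * (q : ℝ) / (q - s) := by apply div_nonneg <;> linarith
  rcases min_cases (s : ℝ) ((q : ℝ) - s) with ⟨hm, _⟩ | ⟨hm, _⟩
  · rw [hm] at hd
    linarith [aux _ hsr hd]
  · rw [hm] at hd
    linarith [aux _ hsr' hd]

/-- Over a block of `q` consecutive integers `r`, the points `β + α r` are spaced modulo one like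
the multiples of `1 / q`. -/
lemma sum_geomKernel_range_le {α : ℝ} {a : ℤ} {q : ℕ} (hq : 0 < q) (ha : IsCoprime a (q : ℤ))
    (hα : |α - a / q| ≤ 1 / (q : ℝ) ^ 2) {M : ℝ} (hM : 0 < M) (β : ℝ) :
    ∑ r ∈ range q, geomKernel M (β + α * r) ≤ 7 * M + 6 * q * (1 + Real.log q) := by
  have hsum := sum_residueMajorant_le hM q
  have h0 := residueMajorant_nonneg hM q
  have hshift : ∑ s ∈ range q, residueMajorant M q (s + 1) =
      ∑ s ∈ Ioc 0 q, residueMajorant M q s := by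
    rw [range_eq_Ico, sum_Ico_add' (residueMajorant M q) 0 q 1]
    exact sum_congr (by ext; simp; omega) fun _ _ => rfl
  have hrange : ∑ s ∈ range q, residueMajorant M q s ≤
      M + ∑ s ∈ Ioc 0 q, residueMajorant M q s := by
    rw [← hshift]
    have e := sum_range_succ' (residueMajorant M q) q
    rw [sum_range_succ] at e
    have h00 : residueMajorant M q 0 = M := if_pos (by norm_num)
    linarith [h0 q]
  calc ∑ r ∈ range q, geomKernel M (β + α * r)
      ≤ ∑ r ∈ range q, (fun s => residueMajorant M q s + residueMajorant M q (q - s))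
          ((⌊q * β⌋ + a * r) % q).toNat :=
        sum_le_sum fun r hr => geomKernel_le_residueMajorant hq hα hM β (mem_range.1 hr)
    _ ≤ ∑ s ∈ range q, (residueMajorant M q s + residueMajorant M q (q - s)) :=
        sum_residues_le q hq a _ ha
          (fun s => residueMajorant M q s + residueMajorant M q (q - s))
          (fun s => add_nonneg (h0 _) (h0 _))
    _ = ∑ s ∈ range q, residueMajorant M q s + ∑ s ∈ range q, residueMajorant M q (s + 1) := by
        rw [sum_add_distrib, ← sum_range_reflect (fun s => residueMajorant M q (s + 1))]
        congr 1
        refine sum_congr rfl fun s hs => ?_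
        have := mem_range.1 hs
        congr 1
        omega
    _ ≤ 7 * M + 6 * q * (1 + Real.log q) := by linarith

lemma sum_geomKernel_Ioc_le {α : ℝ} {a : ℤ} {q : ℕ} (hq : 0 < q) (ha : IsCoprime a (q : ℤ))
    (hα : |α - a / q| ≤ 1 / (q : ℝ) ^ 2) {M : ℝ} (hM : 0 < M) (β : ℝ) (N : ℕ) :
    ∑ n ∈ Ioc 0 N, geomKernel M (β + α * n) ≤
      ((N : ℝ) / q + 1) * (7 * M + 6 * q * (1 + Real.log q)) := by
  have hblocks : ∀ T : ℕ, ∑ n ∈ range (q * T), geomKernel M (β + α * n) ≤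
      T * (7 * M + 6 * q * (1 + Real.log q)) := by
    intro T
    induction T with
    | zero => simp
    | succ T ih =>
      rw [Nat.mul_succ, sum_range_add]
      have := sum_geomKernel_range_le hq ha hα hM (β + α * (q * T))
      have e : ∀ r : ℕ, β + α * ((q * T + r : ℕ) : ℝ) = β + α * (q * T) + α * r := by
        intro r; push_cast; ring
      simp only [e]
      push_cast
      linarith
  have hsub : Ioc 0 N ⊆ range (q * (N / q + 1)) := by
    intro n hn
    have := Nat.lt_mul_div_succ N hq
    simp only [mem_Ioc, mem_range] at hn ⊢
    exact hn.2.trans_lt this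
  refine (sum_le_sum_of_subset_of_nonneg hsub fun _ _ _ => geomKernel_nonneg hM.le _).trans ?_
  refine (hblocks _).trans ?_
  have hlog : 0 ≤ Real.log q := Real.log_natCast_nonneg q
  gcongr
  push_cast
  have : ((N / q : ℕ) : ℝ) ≤ N / q := Nat.cast_div_le
  linarith

/-! ### Sums with one smooth variable -/

/-- For `m ≤ q / 2` the point `α m` is as far from the integers as `a m / q`, up to a factor `2`. -/
lemma geomKernel_le_of_two_mul_le {α : ℝ} {a : ℤ} {q : ℕ} (ha : IsCoprime a (q : ℤ))
    (hα : |α - a / q| ≤ 1 / (q : ℝ) ^ 2) (M : ℝ) {m : ℕ} (hm : 0 < m) (hmq : 2 * m ≤ q) :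
    geomKernel M (α * m) ≤ 2 * geomKernel q ((a / q : ℝ) * m) := by
  have hq : 0 < q := by omega
  have hq' : (0 : ℝ) < q := by exact_mod_cast hq
  have hnorm := norm_intCast_div q hq (a * m)
  rw [show (((a * m : ℤ) : ℝ) / q : ℝ) = (a / q : ℝ) * m by push_cast; ring] at hnorm
  have hpos : 0 < ((a * m) % q).toNat := by
    by_contra h
    have h1 : (a * m) % (q : ℤ) = 0 := by
      have := Int.emod_nonneg (a * m) (b := (q : ℤ)) (by positivity)
      omega
    have h2 : (q : ℤ) ∣ m := ha.symm.dvd_of_dvd_mul_left (Int.dvd_of_emod_eq_zero h1)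
    have := Nat.le_of_dvd hm (by exact_mod_cast h2)
    omega
  have hlt : ((a * m) % q).toNat < q := by
    have := Int.emod_lt_of_pos (a * m) (b := (q : ℤ)) (by positivity)
    omega
  generalize ((a * m) % (q : ℤ)).toNat = s at hnorm hpos hlt
  set t := ‖(((a / q : ℝ) * m : ℝ) : UnitAddCircle)‖ with ht
  have htq : 1 / (q : ℝ) ≤ t := by
    rw [hnorm]
    gcongr
    refine le_min (by exact_mod_cast hpos) ?_
    have : ((s + 1 : ℕ) : ℝ) ≤ q := by exact_mod_cast hlt
    push_cast at this
    linarith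
  have hdist : t ≤ ‖((α * m : ℝ) : UnitAddCircle)‖ + 1 / (2 * q) := by
    rw [ht, show (a / q : ℝ) * m = α * m + ((a / q : ℝ) * m - α * m) by ring, AddCircle.coe_add]
    refine (norm_add_le _ _).trans ?_
    gcongr
    have e1 : ‖(((a / q : ℝ) * m - α * m : ℝ) : UnitAddCircle)‖ ≤ |(a / q : ℝ) * m - α * m| := by
      rw [UnitAddCircle.norm_eq]
      simpa using round_le ((a / q : ℝ) * m - α * m) 0
    refine e1.trans ?_
    rw [← sub_mul, abs_mul, abs_sub_comm, Nat.abs_cast]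
    have h2 : 2 * (m : ℝ) ≤ q := by exact_mod_cast hmq
    calc |α - a / q| * m ≤ (1 / (q : ℝ) ^ 2) * (q / 2) := by gcongr; linarith
      _ = 1 / (2 * q) := by field_simp
  have hq2 : 1 / (2 * (q : ℝ)) = (1 / q) / 2 := by field_simp
  have ht0 : 0 < t := lt_of_lt_of_le (by positivity) htq
  refine (geomKernel_le_inv (t := t / 2) (by positivity) (by rw [hq2] at hdist; linarith)).trans ?_
  rw [geomKernel, max_eq_right (by rw [← one_div]; exact htq), inv_div, div_eq_mul_inv]

/-- The kernel sum that governs `∑ c(m) ∑_{n ≤ x / m} e(mnα)` over `m ≤ N`.  On the block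
`q j ≤ m < q (j + 1)` with `j ≥ 1` the first argument of the kernel is at most `x / (q j)`. -/
lemma sum_geomKernel_div_le {α : ℝ} {a : ℤ} {q : ℕ} (hq : 0 < q) (ha : IsCoprime a (q : ℤ))
    (hα : |α - a / q| ≤ 1 / (q : ℝ) ^ 2) {x N : ℕ} (hqx : q ≤ x) (hN : N ≤ x) :
    ∑ m ∈ Ioc 0 N, geomKernel ((x : ℝ) / m) (α * m) ≤
      32 * ((x : ℝ) / q + N + q) * (1 + Real.log x) := by
  have hq' : (0 : ℝ) < q := by exact_mod_cast hq
  have hx : 0 < x := by omega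
  have hx' : (0 : ℝ) < x := by exact_mod_cast hx
  have hlogq : Real.log q ≤ Real.log x := Real.log_le_log hq' (by exact_mod_cast hqx)
  have hlogq0 : 0 ≤ Real.log q := Real.log_natCast_nonneg q
  set l := 1 + Real.log x with hl
  have hl1 : 1 ≤ l := by linarith
  set F : ℕ → ℝ := fun m => geomKernel ((x : ℝ) / m) (α * m) with hF
  have hF0 : ∀ m, 0 ≤ F m := fun m => geomKernel_nonneg (by positivity) _
  -- On the first block `x / m` is unbounded in terms of `x / q`; but for `m ≤ q / 2` the point `α m`
  -- stays away from the integers, and for `m > q / 2` one has `x / m ≤ 2 x / q`.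
  have hfirst : ∑ m ∈ range q, F m ≤ 14 * (x / q) + 32 * q * l := by
    have hle : ∀ m ∈ range q, F m ≤ 2 * geomKernel q (0 + (a / q : ℝ) * m) +
        geomKernel (2 * (x / q)) (0 + α * m) := by
      intro m hm
      have hmq := mem_range.1 hm
      have hn1 : 0 ≤ geomKernel q (0 + (a / q : ℝ) * m) := geomKernel_nonneg hq'.le _
      have hn2 : 0 ≤ geomKernel (2 * (x / q)) (0 + α * m) := geomKernel_nonneg (by positivity) _
      rcases Nat.eq_zero_or_pos m with rfl | hm0
      -- `x / 0 = 0`, and the kernel with first argument `0` vanishes at `0`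
      · have : F 0 = 0 := by simp [hF, geomKernel]
        rw [this]
        positivity
      by_cases h2 : 2 * m ≤ q
      · have := geomKernel_le_of_two_mul_le ha hα (x / m) hm0 h2
        simp only [hF, zero_add] at hn1 hn2 ⊢
        linarith
      · have hm' : (0 : ℝ) < m := by exact_mod_cast hm0
        have h3 : (q : ℝ) ≤ 2 * m := by exact_mod_cast (not_le.1 h2).le
        have := geomKernel_mono (M := x / m) (N := 2 * (x / q)) (by positivity) (by
          rw [← mul_div_assoc, div_le_div_iff₀ hm' hq']; nlinarith) (α * m)
        simp only [hF, zero_add] at hn1 hn2 ⊢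
        linarith
    refine (sum_le_sum hle).trans ?_
    rw [sum_add_distrib, ← mul_sum]
    have h1 := sum_geomKernel_range_le hq ha (α := a / q) (by simp) hq' 0
    have h2 := sum_geomKernel_range_le hq ha hα (M := 2 * (x / q)) (by positivity) 0
    have h3 : (q : ℝ) * (1 + Real.log q) ≤ q * l := by gcongr; linarith
    have h4 : (q : ℝ) ≤ q * l := le_mul_of_one_le_right hq'.le hl1
    linarith
  have hblocks : ∀ t : ℕ, ∑ m ∈ range (q * (t + 1)), F m ≤
      14 * (x / q) + 32 * q * l + ∑ j ∈ Ioc 0 t, (7 * (x / q) * (1 / (j : ℝ)) + 6 * q * l) := by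
    intro t
    induction t with
    | zero => simpa using hfirst
    | succ t ih =>
      rw [Nat.mul_succ, sum_range_add, sum_Ioc_succ_top (Nat.zero_le t), ← add_assoc]
      refine add_le_add ih ?_
      have ht : (0 : ℝ) < ((t + 1 : ℕ) : ℝ) := by positivity
      have hle : ∀ r ∈ range q, F (q * (t + 1) + r) ≤
          geomKernel (x / (q * (t + 1 : ℕ))) (α * (q * (t + 1 : ℕ)) + α * r) := by
        intro r _
        simp only [hF]
        have e : α * ((q * (t + 1) + r : ℕ) : ℝ) = α * (q * (t + 1 : ℕ)) + α * r := by
          push_cast; ring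
        rw [e]
        refine geomKernel_mono (by positivity) ?_ _
        gcongr
        push_cast
        linarith [Nat.cast_nonneg (α := ℝ) r]
      refine (sum_le_sum hle).trans ?_
      refine (sum_geomKernel_range_le hq ha hα (by positivity) _).trans ?_
      have h3 : (q : ℝ) * (1 + Real.log q) ≤ q * l := by gcongr; linarith
      have h4 : 7 * ((x : ℝ) / (q * (t + 1 : ℕ))) = 7 * (x / q) * (1 / ((t + 1 : ℕ) : ℝ)) := by
        field_simp
      linarith
  have hsub : Ioc 0 N ⊆ range (q * (N / q + 1)) := by
    intro n hn
    have := Nat.lt_mul_div_succ N hq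
    simp only [mem_Ioc, mem_range] at hn ⊢
    exact hn.2.trans_lt this
  refine (sum_le_sum_of_subset_of_nonneg hsub fun m _ _ => hF0 m).trans ((hblocks _).trans ?_)
  rw [sum_add_distrib, ← mul_sum, sum_const, Nat.card_Ioc, Nat.sub_zero, nsmul_eq_mul]
  have ht1 : ((N / q : ℕ) : ℝ) * q ≤ N := by exact_mod_cast Nat.div_mul_le_self N q
  have ht2 : Real.log ((N / q : ℕ) : ℝ) ≤ Real.log x := by
    rcases Nat.eq_zero_or_pos (N / q) with h | h
    · rw [h]; simpa using Real.log_natCast_nonneg x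
    · exact Real.log_le_log (by exact_mod_cast h)
        (by exact_mod_cast (Nat.div_le_self N q).trans hN)
  have ht3 := sum_Ioc_inv_le (N / q)
  have hxq : (0 : ℝ) < x / q := by positivity
  have h5 : 7 * ((x : ℝ) / q) * ∑ i ∈ Ioc 0 (N / q), 1 / (i : ℝ) ≤ 7 * (x / q) * l := by
    gcongr
    linarith
  have h6 : ((N / q : ℕ) : ℝ) * (6 * q * l) ≤ 6 * N * l := by nlinarith
  have h7 : (x : ℝ) / q ≤ x / q * l := le_mul_of_one_le_right hxq.le hl1
  have h8 : 0 ≤ (N : ℝ) * l := by positivity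
  nlinarith

/-! ### Bilinear sums -/

lemma norm_sum_expChar_filter_le {M : ℕ} (hM : 0 < M) (x n₁ n₂ : ℕ) (h₁ : 0 < n₁) (h₂ : 0 < n₂)
    (β : ℝ) :
    ‖∑ m ∈ Ico M (2 * M) with m * n₁ ≤ x ∧ m * n₂ ≤ x, expChar (m * β)‖ ≤ geomKernel M β := by
  have e : {m ∈ Ico M (2 * M) | m * n₁ ≤ x ∧ m * n₂ ≤ x} =
      Ico M (max M (min (2 * M) (min (x / n₁) (x / n₂) + 1))) := by
    ext m
    simp only [mem_filter, mem_Ico, ← Nat.le_div_iff_mul_le h₁, ← Nat.le_div_iff_mul_le h₂]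
    omega
  rw [e]
  refine norm_sum_expChar_le (by exact_mod_cast hM) (le_max_left _ _) ?_ β
  have : max M (min (2 * M) (min (x / n₁) (x / n₂) + 1)) ≤ 2 * M := by omega
  have h : ((max M (min (2 * M) (min (x / n₁) (x / n₂) + 1)) : ℕ) : ℝ) ≤ ((2 * M : ℕ) : ℝ) := by
    exact_mod_cast this
  push_cast at h ⊢
  linarith

/-- Opening the square: the mean square over `M ≤ m < 2M` of the inner sums is a quadratic form
in `b` whose matrix is dominated by the geometric kernel. -/
lemma sum_normSq_inner_le {α : ℝ} {M : ℕ} (hM : 0 < M) (x : ℕ) (b : ℕ → ℝ) :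
    ∑ m ∈ Ico M (2 * M), ‖∑ n ∈ Ioc 0 (x / m), (b n : ℂ) * expChar ((m * n : ℕ) * α)‖ ^ 2 ≤
      ∑ n₁ ∈ Ioc 0 (x / M), ∑ n₂ ∈ Ioc 0 (x / M),
        |b n₁| * |b n₂| * geomKernel M (((n₁ : ℝ) - n₂) * α) := by
  have hinner : ∀ m ∈ Ico M (2 * M),
      ∑ n ∈ Ioc 0 (x / m), (b n : ℂ) * expChar ((m * n : ℕ) * α) =
      ∑ n ∈ Ioc 0 (x / M), if m * n ≤ x then (b n : ℂ) * expChar ((m * n : ℕ) * α) else 0 := by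
    intro m hm
    rw [← sum_filter]
    refine sum_congr ?_ fun _ _ => rfl
    ext n
    have hm' := mem_Ico.1 hm
    have hm0 : 0 < m := hM.trans_le hm'.1
    simp only [mem_Ioc, mem_filter, Nat.le_div_iff_mul_le hm0, Nat.le_div_iff_mul_le hM]
    constructor
    · rintro ⟨h1, h2⟩
      exact ⟨⟨h1, (Nat.mul_le_mul_left n hm'.1).trans h2⟩, by rwa [mul_comm]⟩
    · rintro ⟨⟨h1, _⟩, h3⟩
      exact ⟨h1, by rwa [mul_comm]⟩
  have hexpand : ((∑ m ∈ Ico M (2 * M),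
      ‖∑ n ∈ Ioc 0 (x / m), (b n : ℂ) * expChar ((m * n : ℕ) * α)‖ ^ 2 : ℝ) : ℂ) =
      ∑ n₁ ∈ Ioc 0 (x / M), ∑ n₂ ∈ Ioc 0 (x / M), (b n₁ : ℂ) * b n₂ *
        ∑ m ∈ Ico M (2 * M) with m * n₁ ≤ x ∧ m * n₂ ≤ x, expChar (m * (((n₁ : ℝ) - n₂) * α)) := by
    rw [Complex.ofReal_sum]
    have hsq : ∀ m ∈ Ico M (2 * M),
        ((‖∑ n ∈ Ioc 0 (x / m), (b n : ℂ) * expChar ((m * n : ℕ) * α)‖ ^ 2 : ℝ) : ℂ) =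
        ∑ n₁ ∈ Ioc 0 (x / M), ∑ n₂ ∈ Ioc 0 (x / M), if m * n₁ ≤ x ∧ m * n₂ ≤ x then
          (b n₁ : ℂ) * b n₂ * expChar (m * (((n₁ : ℝ) - n₂) * α)) else 0 := by
      intro m hm
      rw [hinner m hm, Complex.ofReal_pow, ← Complex.mul_conj', map_sum, sum_mul_sum]
      refine sum_congr rfl fun n₁ _ => sum_congr rfl fun n₂ _ => ?_
      by_cases h1 : m * n₁ ≤ x <;> by_cases h2 : m * n₂ ≤ x <;> simp only [h1, h2, if_true,
        if_false, and_true, and_false, zero_mul, mul_zero, map_zero]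
      rw [map_mul, Complex.conj_ofReal]
      have := expChar_sub ((m * n₁ : ℕ) * α) ((m * n₂ : ℕ) * α)
      rw [show (m : ℝ) * (((n₁ : ℝ) - n₂) * α) = (m * n₁ : ℕ) * α - (m * n₂ : ℕ) * α by
        push_cast; ring, this]
      ring
    rw [sum_congr rfl hsq, sum_comm]
    refine sum_congr rfl fun n₁ _ => ?_
    rw [sum_comm]
    refine sum_congr rfl fun n₂ _ => ?_
    rw [mul_sum, sum_filter]
  have hreal : ∑ m ∈ Ico M (2 * M),
      ‖∑ n ∈ Ioc 0 (x / m), (b n : ℂ) * expChar ((m * n : ℕ) * α)‖ ^ 2 =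
      ‖((∑ m ∈ Ico M (2 * M),
      ‖∑ n ∈ Ioc 0 (x / m), (b n : ℂ) * expChar ((m * n : ℕ) * α)‖ ^ 2 : ℝ) : ℂ)‖ := by
    rw [Complex.norm_real, Real.norm_of_nonneg (sum_nonneg fun _ _ => by positivity)]
  rw [hreal, hexpand]
  refine (norm_sum_le _ _).trans (sum_le_sum fun n₁ h₁ => ?_)
  refine (norm_sum_le _ _).trans (sum_le_sum fun n₂ h₂ => ?_)
  rw [norm_mul, norm_mul, Complex.norm_real, Complex.norm_real, Real.norm_eq_abs, Real.norm_eq_abs]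
  gcongr
  exact norm_sum_expChar_filter_le hM x n₁ n₂ (mem_Ioc.1 h₁).1 (mem_Ioc.1 h₂).1 _

/-- One dyadic block: Cauchy's inequality in `m` removes the coefficients `c`, and
`|b n₁ * b n₂| ≤ (b n₁ ^ 2 + b n₂ ^ 2) / 2` reduces the quadratic form to its row sums. -/
lemma norm_bilinear_block_sq_le {α : ℝ} {a : ℤ} {q : ℕ} (hq : 0 < q) (ha : IsCoprime a (q : ℤ))
    (hα : |α - a / q| ≤ 1 / (q : ℝ) ^ 2) {M : ℕ} (hM : 0 < M) (x : ℕ) (c b : ℕ → ℝ)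
    (hc : ∀ m, |c m| ≤ 1) :
    ‖∑ m ∈ Ico M (2 * M), (c m : ℂ) *
      ∑ n ∈ Ioc 0 (x / m), (b n : ℂ) * expChar ((m * n : ℕ) * α)‖ ^ 2 ≤
      M * ((∑ n ∈ Ioc 0 (x / M), b n ^ 2) *
        ((((x / M : ℕ) : ℝ) / q + 1) * (7 * M + 6 * q * (1 + Real.log q)))) := by
  have hM' : (0 : ℝ) < M := by exact_mod_cast hM
  set T : ℕ → ℂ := fun m => ∑ n ∈ Ioc 0 (x / m), (b n : ℂ) * expChar ((m * n : ℕ) * α) with hT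
  have h1 : ‖∑ m ∈ Ico M (2 * M), (c m : ℂ) * T m‖ ≤ ∑ m ∈ Ico M (2 * M), ‖T m‖ := by
    refine (norm_sum_le _ _).trans (sum_le_sum fun m _ => ?_)
    rw [norm_mul, Complex.norm_real, Real.norm_eq_abs]
    exact mul_le_of_le_one_left (norm_nonneg _) (hc m)
  have h2 : (∑ m ∈ Ico M (2 * M), ‖T m‖) ^ 2 ≤ M * ∑ m ∈ Ico M (2 * M), ‖T m‖ ^ 2 := by
    have := sq_sum_le_card_mul_sum_sq (s := Ico M (2 * M)) (f := fun m => ‖T m‖)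
    rwa [Nat.card_Ico, show 2 * M - M = M by omega] at this
  refine (pow_le_pow_left₀ (norm_nonneg _) h1 2).trans (h2.trans ?_)
  gcongr
  refine (sum_normSq_inner_le hM x b).trans ?_
  set R := (((x / M : ℕ) : ℝ) / q + 1) * (7 * M + 6 * q * (1 + Real.log q)) with hR
  have hrow : ∀ n₁ : ℕ, ∑ n₂ ∈ Ioc 0 (x / M), geomKernel M (((n₁ : ℝ) - n₂) * α) ≤ R := by
    intro n₁
    have := sum_geomKernel_Ioc_le hq ha hα hM' (-(n₁ * α)) (x / M)
    refine le_trans (le_of_eq (sum_congr rfl fun n₂ _ => ?_)) this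
    rw [← geomKernel_neg]
    ring_nf
  have hsymm : ∑ n₁ ∈ Ioc 0 (x / M), ∑ n₂ ∈ Ioc 0 (x / M),
      b n₂ ^ 2 * geomKernel M (((n₁ : ℝ) - n₂) * α) =
      ∑ n₁ ∈ Ioc 0 (x / M), ∑ n₂ ∈ Ioc 0 (x / M),
      b n₁ ^ 2 * geomKernel M (((n₁ : ℝ) - n₂) * α) := by
    rw [sum_comm]
    refine sum_congr rfl fun n₁ _ => sum_congr rfl fun n₂ _ => ?_
    rw [← geomKernel_neg]
    ring_nf
  calc ∑ n₁ ∈ Ioc 0 (x / M), ∑ n₂ ∈ Ioc 0 (x / M),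
        |b n₁| * |b n₂| * geomKernel M (((n₁ : ℝ) - n₂) * α)
      ≤ ∑ n₁ ∈ Ioc 0 (x / M), ∑ n₂ ∈ Ioc 0 (x / M),
        (b n₁ ^ 2 * geomKernel M (((n₁ : ℝ) - n₂) * α) / 2 +
          b n₂ ^ 2 * geomKernel M (((n₁ : ℝ) - n₂) * α) / 2) := by
        refine sum_le_sum fun n₁ _ => sum_le_sum fun n₂ _ => ?_
        have hK := geomKernel_nonneg hM'.le (((n₁ : ℝ) - n₂) * α)
        have := two_mul_le_add_sq |b n₁| |b n₂|
        rw [sq_abs, sq_abs] at this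
        nlinarith
    _ = ∑ n₁ ∈ Ioc 0 (x / M), b n₁ ^ 2 *
          ∑ n₂ ∈ Ioc 0 (x / M), geomKernel M (((n₁ : ℝ) - n₂) * α) := by
        simp only [sum_add_distrib, ← sum_div]
        rw [hsymm, add_halves]
        simp only [mul_sum]
    _ ≤ ∑ n₁ ∈ Ioc 0 (x / M), b n₁ ^ 2 * R := by
        gcongr with n₁ _
        exact hrow n₁
    _ = _ := by rw [sum_mul]

lemma sum_Ioc_eq_sum_dyadic (F : ℕ → ℂ) {x : ℕ} (hF : ∀ m, x < m → F m = 0) :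
    ∑ m ∈ Ioc 0 x, F m = ∑ i ∈ range (Nat.log 2 x + 1), ∑ m ∈ Ico (2 ^ i) (2 * 2 ^ i), F m := by
  have hI : ∀ I : ℕ, ∑ m ∈ Ico 1 (2 ^ I), F m =
      ∑ i ∈ range I, ∑ m ∈ Ico (2 ^ i) (2 * 2 ^ i), F m := by
    intro I
    induction I with
    | zero => simp
    | succ I ih =>
      rw [sum_range_succ, ← ih, pow_succ', sum_Ico_consecutive _ Nat.one_le_two_pow (by omega)]
  rw [← hI]
  have hlt := Nat.lt_pow_succ_log_self (b := 2) (by norm_num) x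
  refine sum_subset ?_ ?_
  · intro m hm
    simp only [mem_Ioc, mem_Ico] at hm ⊢
    exact ⟨hm.1, lt_of_le_of_lt hm.2 hlt⟩
  · intro m hm hm'
    simp only [mem_Ioc, mem_Ico] at hm hm'
    exact hF m (by omega)

lemma natLog_add_one_le (x : ℕ) : ((Nat.log 2 x + 1 : ℕ) : ℝ) ≤ 2 * (1 + Real.log x) := by
  rcases Nat.eq_zero_or_pos x with rfl | hx
  · simp
  have h1 : ((2 ^ Nat.log 2 x : ℕ) : ℝ) ≤ x := by exact_mod_cast Nat.pow_log_le_self 2 hx.ne'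
  have h2 := Real.log_le_log (by positivity) h1
  push_cast at h2
  rw [Real.log_pow] at h2
  have := Real.log_two_gt_d9
  push_cast
  nlinarith [Nat.cast_nonneg (α := ℝ) (Nat.log 2 x)]

/-- Vinogradov's bound for a bilinear sum over `mn ≤ x` in which both variables exceed `U`. -/
lemma norm_bilinear_sq_le {α : ℝ} {a : ℤ} {q : ℕ} (hq : 0 < q) (ha : IsCoprime a (q : ℤ))
    (hα : |α - a / q| ≤ 1 / (q : ℝ) ^ 2) {x U : ℕ} (hqx : q ≤ x) (hU : 0 < U) (c b : ℕ → ℝ)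
    (hc : ∀ m, |c m| ≤ 1) (hcU : ∀ m ≤ U, c m = 0) (hbU : ∀ n ≤ U, b n = 0) {K : ℝ} (hK : 0 ≤ K)
    (hb : ∀ N ≤ x, ∑ n ∈ Ioc 0 N, b n ^ 2 ≤ K * N) :
    ‖∑ m ∈ Ioc 0 x, (c m : ℂ) *
      ∑ n ∈ Ioc 0 (x / m), (b n : ℂ) * expChar ((m * n : ℕ) * α)‖ ^ 2 ≤
      84 * K * (1 + Real.log x) ^ 3 * x * ((x : ℝ) / q + q + x / U) := by
  have hq' : (0 : ℝ) < q := by exact_mod_cast hq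
  have hx' : (0 : ℝ) < x := by exact_mod_cast hq.trans_le hqx
  have hU' : (0 : ℝ) < U := by exact_mod_cast hU
  have hlogq : Real.log q ≤ Real.log x := Real.log_le_log hq' (by exact_mod_cast hqx)
  have hlogq0 : 0 ≤ Real.log q := Real.log_natCast_nonneg q
  set l := 1 + Real.log x with hl
  have hl1 : 1 ≤ l := by linarith
  set D := 21 * K * l * x * ((x : ℝ) / q + q + x / U) with hD
  have hD0 : 0 ≤ D := by positivity
  set F : ℕ → ℂ := fun m => (c m : ℂ) *
      ∑ n ∈ Ioc 0 (x / m), (b n : ℂ) * expChar ((m * n : ℕ) * α) with hF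
  have hblock : ∀ M : ℕ, 0 < M → ‖∑ m ∈ Ico M (2 * M), F m‖ ^ 2 ≤ D := by
    intro M hM
    have hM' : (0 : ℝ) < M := by exact_mod_cast hM
    -- outside `U / 2 < M < x / U` the block vanishes
    by_cases h1 : 2 * M ≤ U
    · rw [sum_eq_zero]
      · simpa using hD0
      · intro m hm
        simp only [hF]
        rw [hcU m ((mem_Ico.1 hm).2.le.trans h1)]
        simp
    by_cases h2 : x / M ≤ U
    · rw [sum_eq_zero]
      · simpa using hD0
      · intro m hm
        simp only [hF]
        rw [sum_eq_zero, mul_zero]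
        intro n hn
        rw [hbU n, Complex.ofReal_zero, zero_mul]
        exact ((mem_Ioc.1 hn).2.trans (Nat.div_le_div_left (mem_Ico.1 hm).1 hM)).trans h2
    refine (norm_bilinear_block_sq_le hq ha hα hM x c b hc).trans ?_
    have hN := hb (x / M) (Nat.div_le_self _ _)
    have hNx : ((x / M : ℕ) : ℝ) * M ≤ x := by exact_mod_cast Nat.div_mul_le_self x M
    have hNU : (U : ℝ) ≤ ((x / M : ℕ) : ℝ) := by exact_mod_cast (not_le.1 h2).le
    have hMU : (U : ℝ) ≤ 2 * M := by exact_mod_cast (not_le.1 h1).le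
    set N : ℝ := ((x / M : ℕ) : ℝ) with hNdef
    have hN0 : 0 < N := hU'.trans_le hNU
    have hMle : (M : ℝ) ≤ x / U := by
      rw [le_div_iff₀ hU']; nlinarith
    have hNle : N ≤ 2 * (x / U) := by
      rw [← mul_div_assoc, le_div_iff₀ hU']; nlinarith
    have hkey : (N / q + 1) * (7 * M + 6 * q * (1 + Real.log q)) ≤
        21 * l * ((x : ℝ) / q + q + x / U) := by
      have e : (N / q + 1) * (7 * M + 6 * q * (1 + Real.log q)) =
          7 * (N * M / q) + 7 * M + (6 * N + 6 * q) * (1 + Real.log q) := by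
        field_simp
      have h3 : N * M / q ≤ x / q := by gcongr
      have h4 : (6 * N + 6 * q) * (1 + Real.log q) ≤ (6 * N + 6 * q) * l := by gcongr; linarith
      have h5 : (x : ℝ) / q ≤ x / q * l := le_mul_of_one_le_right (by positivity) hl1
      have h6 : (x : ℝ) / U ≤ x / U * l := le_mul_of_one_le_right (by positivity) hl1
      have h7 : N * l ≤ 2 * (x / U) * l := by gcongr
      have h8 : 0 ≤ (q : ℝ) * l := by positivity
      have h9 : 0 ≤ (x : ℝ) / q * l := by positivity
      rw [e]
      nlinarith
    calc (M : ℝ) * ((∑ n ∈ Ioc 0 (x / M), b n ^ 2) *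
          ((N / q + 1) * (7 * M + 6 * q * (1 + Real.log q))))
        ≤ M * ((K * N) * (21 * l * ((x : ℝ) / q + q + x / U))) := by
          gcongr
      _ = 21 * K * l * (N * M) * ((x : ℝ) / q + q + x / U) := by ring
      _ ≤ D := by
          rw [hD]
          gcongr
  rw [show ∑ m ∈ Ioc 0 x, (c m : ℂ) *
      ∑ n ∈ Ioc 0 (x / m), (b n : ℂ) * expChar ((m * n : ℕ) * α) = ∑ m ∈ Ioc 0 x, F m from rfl,
    sum_Ioc_eq_sum_dyadic F (fun m hm => by simp [hF, Nat.div_eq_of_lt hm])]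
  set I := Nat.log 2 x + 1 with hI
  have hsum : ‖∑ i ∈ range I, ∑ m ∈ Ico (2 ^ i) (2 * 2 ^ i), F m‖ ≤ I * √D := by
    refine (norm_sum_le _ _).trans ?_
    have : ∀ i ∈ range I, ‖∑ m ∈ Ico (2 ^ i) (2 * 2 ^ i), F m‖ ≤ √D := fun i _ =>
      Real.le_sqrt_of_sq_le (hblock (2 ^ i) (by positivity))
    simpa using sum_le_sum this
  have hIl : (I : ℝ) ≤ 2 * l := natLog_add_one_le x
  calc ‖∑ i ∈ range I, ∑ m ∈ Ico (2 ^ i) (2 * 2 ^ i), F m‖ ^ 2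
      ≤ (I * √D) ^ 2 := pow_le_pow_left₀ (norm_nonneg _) hsum 2
    _ = (I : ℝ) ^ 2 * D := by rw [mul_pow, Real.sq_sqrt hD0]
    _ ≤ (2 * l) ^ 2 * D := by gcongr
    _ = _ := by rw [hD]; ring

/-! ### Divisor functions and Dirichlet convolution -/

/-- The `j`-fold divisor function `d_j = 1 * ⋯ * 1` (`j` factors), with real values. -/
def divisorFun (j : ℕ) : ArithmeticFunction ℝ :=
  ((ArithmeticFunction.zeta : ArithmeticFunction ℕ) : ArithmeticFunction ℝ) ^ j

lemma divisorFun_zero : divisorFun 0 = 1 := pow_zero _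

lemma divisorFun_one_apply {n : ℕ} (hn : n ≠ 0) : divisorFun 1 n = 1 := by
  simp [divisorFun, hn]

lemma divisorFun_succ (j : ℕ) : divisorFun (j + 1) = divisorFun j * divisorFun 1 := by
  simp [divisorFun, pow_succ]

lemma divisorFun_add (i j : ℕ) : divisorFun (i + j) = divisorFun i * divisorFun j :=
  pow_add _ _ _

lemma divisorFun_succ_apply (j n : ℕ) :
    divisorFun (j + 1) n = ∑ d ∈ n.divisors, divisorFun j d := by
  rw [divisorFun_succ, divisorFun, divisorFun, pow_one, ArithmeticFunction.coe_mul_zeta_apply]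

lemma divisorFun_nonneg (j n : ℕ) : 0 ≤ divisorFun j n := by
  induction j generalizing n with
  | zero =>
    rw [divisorFun_zero, ArithmeticFunction.one_apply]
    split_ifs <;> norm_num
  | succ j ih =>
    rw [divisorFun_succ_apply]
    exact sum_nonneg fun d _ => ih d

lemma divisorFun_le_succ (j n : ℕ) : divisorFun j n ≤ divisorFun (j + 1) n := by
  rcases eq_or_ne n 0 with rfl | hn
  · simp
  rw [divisorFun_succ_apply]
  exact single_le_sum (f := fun d => divisorFun j d) (fun d _ => divisorFun_nonneg j d)
    (Nat.mem_divisors_self n hn)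

lemma divisorFun_mono {i j : ℕ} (h : i ≤ j) (n : ℕ) : divisorFun i n ≤ divisorFun j n :=
  monotone_nat_of_le_succ (f := fun j => divisorFun j n) (fun j => divisorFun_le_succ j n) h

lemma divisorFun_apply_one (j : ℕ) : divisorFun j 1 = 1 := by
  induction j with
  | zero => simp [divisorFun_zero]
  | succ j ih => rw [divisorFun_succ_apply]; simp [ih]

/-- Submultiplicativity: every divisor of `m * n` is a divisor of `m` times a divisor of `n`. -/
lemma divisorFun_mul_le (j m n : ℕ) :
    divisorFun j (m * n) ≤ divisorFun j m * divisorFun j n := by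
  induction j generalizing m n with
  | zero =>
    simp only [divisorFun_zero, ArithmeticFunction.one_apply, mul_eq_one]
    split_ifs <;> first | (exfalso; tauto) | norm_num
  | succ j ih =>
    simp only [divisorFun_succ_apply]
    rw [sum_mul_sum, ← sum_product', Nat.divisors_mul]
    change ∑ d ∈ image (fun p : ℕ × ℕ => p.1 * p.2) (m.divisors ×ˢ n.divisors), divisorFun j d ≤ _
    refine (sum_image_le_of_nonneg ?_).trans (sum_le_sum fun p _ => ih p.1 p.2)
    exact fun p _ => divisorFun_nonneg j _

/-- In particular `d_j ^ 2 ≤ d_(j²)`, which gives the mean square of `d_j`. -/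
lemma divisorFun_mul_divisorFun_le (j i n : ℕ) :
    divisorFun j n * divisorFun i n ≤ divisorFun (j * i) n := by
  induction i generalizing n with
  | zero =>
    rw [mul_zero, divisorFun_zero, ArithmeticFunction.one_apply]
    split_ifs with h
    · simp [h, divisorFun_apply_one]
    · simp
  | succ i ih =>
    rw [divisorFun_succ i, mul_add, mul_one, divisorFun_add, ArithmeticFunction.mul_apply,
      ArithmeticFunction.mul_apply, mul_sum]
    refine sum_le_sum fun p hp => ?_
    obtain ⟨hpn, hn⟩ := Nat.mem_divisorsAntidiagonal.1 hp
    have h2 : p.2 ≠ 0 := by rintro h; rw [h, mul_zero] at hpn; exact hn hpn.symm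
    rw [divisorFun_one_apply h2, mul_one, ← hpn]
    calc divisorFun j (p.1 * p.2) * divisorFun i p.1
        ≤ divisorFun j p.1 * divisorFun j p.2 * divisorFun i p.1 :=
          mul_le_mul_of_nonneg_right (divisorFun_mul_le _ _ _) (divisorFun_nonneg _ _)
      _ = divisorFun j p.1 * divisorFun i p.1 * divisorFun j p.2 := by ring
      _ ≤ _ := mul_le_mul_of_nonneg_right (ih _) (divisorFun_nonneg _ _)

/-- Rearrangement of a twisted sum over a Dirichlet convolution. -/
lemma sum_mul_smul {E : Type*} [AddCommGroup E] [Module ℝ E] (F G : ArithmeticFunction ℝ)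
    (φ : ℕ → E) (N : ℕ) :
    ∑ n ∈ Ioc 0 N, (F * G) n • φ n =
      ∑ m ∈ Ioc 0 N, F m • ∑ k ∈ Ioc 0 (N / m), G k • φ (m * k) := by
  have h1 : ∀ n ∈ Ioc 0 N, (F * G) n • φ n =
      ∑ p ∈ Ioc 0 N ×ˢ Ioc 0 N with p.1 * p.2 = n, (F p.1 * G p.2) • φ (p.1 * p.2) := by
    intro n hn
    have hn' := mem_Ioc.1 hn
    rw [ArithmeticFunction.mul_apply, Nat.divisorsAntidiagonal_eq_prod_filter_of_le hn'.1.ne' hn'.2,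
      sum_smul]
    refine sum_congr rfl fun p hp => ?_
    rw [(mem_filter.1 hp).2]
  have h2 : ∀ m ∈ Ioc 0 N, F m • ∑ k ∈ Ioc 0 (N / m), G k • φ (m * k) =
      ∑ k ∈ Ioc 0 N, if m * k ≤ N then (F m * G k) • φ (m * k) else 0 := by
    intro m hm
    have hm' := mem_Ioc.1 hm
    rw [smul_sum, ← sum_filter]
    refine sum_congr ?_ fun k _ => by rw [mul_smul]
    ext k
    simp only [mem_Ioc, mem_filter, Nat.le_div_iff_mul_le hm'.1, mul_comm k m]
    constructor
    · rintro ⟨h, h'⟩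
      exact ⟨⟨h, (Nat.le_mul_of_pos_left k hm'.1).trans h'⟩, h'⟩
    · rintro ⟨⟨h, _⟩, h'⟩
      exact ⟨h, h'⟩
  rw [sum_congr rfl h1, sum_congr rfl h2, ← sum_product', ← sum_filter,
    ← sum_fiberwise_of_maps_to (t := Ioc 0 N) (g := fun p : ℕ × ℕ => p.1 * p.2)]
  · refine sum_congr rfl fun n hn => ?_
    refine sum_congr ?_ fun _ _ => rfl
    ext p
    simp only [mem_filter, mem_product, mem_Ioc] at hn ⊢
    constructor
    · rintro ⟨h, h'⟩
      exact ⟨⟨h, h'.le.trans hn.2⟩, h'⟩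
    · rintro ⟨⟨h, _⟩, h'⟩
      exact ⟨h, h'⟩
  · intro p hp
    simp only [mem_filter, mem_product, mem_Ioc] at hp ⊢
    exact ⟨Nat.mul_pos hp.1.1.1 hp.1.2.1, hp.2⟩

lemma sum_divisorFun_div_le (j N : ℕ) :
    ∑ n ∈ Ioc 0 N, divisorFun j n * (1 / n) ≤ (1 + Real.log N) ^ j := by
  have hl : 0 ≤ 1 + Real.log N := by linarith [Real.log_natCast_nonneg N]
  induction j with
  | zero =>
    simp only [divisorFun_zero, ArithmeticFunction.one_apply, ite_mul, one_mul, zero_mul, pow_zero]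
    rw [sum_ite_eq' (Ioc 0 N) 1]
    split_ifs <;> norm_num
  | succ j ih =>
    have h := sum_mul_smul (divisorFun j) (divisorFun 1) (fun n => 1 / (n : ℝ)) N
    simp only [smul_eq_mul] at h
    rw [divisorFun_succ, h, pow_succ]
    calc ∑ m ∈ Ioc 0 N, divisorFun j m * ∑ k ∈ Ioc 0 (N / m),
          divisorFun 1 k * (1 / ((m * k : ℕ) : ℝ))
        ≤ ∑ m ∈ Ioc 0 N, divisorFun j m * (1 / m) * (1 + Real.log N) := by
          refine sum_le_sum fun m hm => ?_
          rw [mul_assoc]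
          refine mul_le_mul_of_nonneg_left ?_ (divisorFun_nonneg _ _)
          have e : ∀ k ∈ Ioc 0 (N / m), divisorFun 1 k * (1 / ((m * k : ℕ) : ℝ)) =
              1 / m * (1 / k) := by
            intro k hk
            rw [divisorFun_one_apply (mem_Ioc.1 hk).1.ne']
            push_cast
            rw [one_mul, one_div_mul_one_div]
          rw [sum_congr rfl e, ← mul_sum]
          refine mul_le_mul_of_nonneg_left ?_ (by positivity)
          refine le_trans ?_ (sum_Ioc_inv_le N)
          exact sum_le_sum_of_subset_of_nonneg
            (Ioc_subset_Ioc_right (Nat.div_le_self _ _)) fun _ _ _ => by positivity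
      _ = (∑ m ∈ Ioc 0 N, divisorFun j m * (1 / m)) * (1 + Real.log N) := by rw [sum_mul]
      _ ≤ _ := mul_le_mul_of_nonneg_right ih hl

lemma sum_divisorFun_le (j N : ℕ) :
    ∑ n ∈ Ioc 0 N, divisorFun (j + 1) n ≤ N * (1 + Real.log N) ^ j := by
  have h := sum_mul_smul (divisorFun j) (divisorFun 1) (fun _ => (1 : ℝ)) N
  simp only [smul_eq_mul, mul_one] at h
  rw [divisorFun_succ, h]
  calc ∑ m ∈ Ioc 0 N, divisorFun j m * ∑ k ∈ Ioc 0 (N / m), divisorFun 1 k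
      ≤ ∑ m ∈ Ioc 0 N, N * (divisorFun j m * (1 / m)) := by
        refine sum_le_sum fun m _ => ?_
        have e : ∑ k ∈ Ioc 0 (N / m), divisorFun 1 k = ((N / m : ℕ) : ℝ) := by
          rw [sum_congr rfl fun k hk => divisorFun_one_apply (mem_Ioc.1 hk).1.ne']
          simp
        rw [e]
        have : ((N / m : ℕ) : ℝ) ≤ N / m := Nat.cast_div_le
        calc divisorFun j m * ((N / m : ℕ) : ℝ) ≤ divisorFun j m * (N / m) :=
              mul_le_mul_of_nonneg_left this (divisorFun_nonneg _ _)
          _ = _ := by ring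
    _ ≤ _ := by
        rw [← mul_sum]
        exact mul_le_mul_of_nonneg_left (sum_divisorFun_div_le j N) (by positivity)

lemma abs_mul_apply_le {F₁ F₂ G₁ G₂ : ArithmeticFunction ℝ} (h₁ : ∀ n, |F₁ n| ≤ G₁ n)
    (h₂ : ∀ n, |F₂ n| ≤ G₂ n) (n : ℕ) : |(F₁ * F₂) n| ≤ (G₁ * G₂) n := by
  rw [ArithmeticFunction.mul_apply, ArithmeticFunction.mul_apply]
  refine (abs_sum_le_sum_abs _ _).trans (sum_le_sum fun p _ => ?_)
  rw [abs_mul]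
  exact mul_le_mul (h₁ _) (h₂ _) (abs_nonneg _) ((abs_nonneg _).trans (h₁ _))

lemma abs_pow_apply_le {F : ArithmeticFunction ℝ} (h : ∀ n, |F n| ≤ divisorFun 1 n) (j n : ℕ) :
    |(F ^ j) n| ≤ divisorFun j n := by
  induction j generalizing n with
  | zero =>
    rw [pow_zero, divisorFun_zero, ArithmeticFunction.one_apply]
    split_ifs <;> simp
  | succ j ih =>
    rw [pow_succ, divisorFun_succ]
    exact abs_mul_apply_le ih h n

lemma abs_mul_apply_le_divisorFun {F G : ArithmeticFunction ℝ} {C : ℝ} {i j : ℕ}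
    (hF : ∀ n, |F n| ≤ divisorFun i n) (hG : ∀ n, |G n| ≤ C * divisorFun j n) (n : ℕ) :
    |(F * G) n| ≤ C * divisorFun (i + j) n := by
  rw [ArithmeticFunction.mul_apply, divisorFun_add, ArithmeticFunction.mul_apply, mul_sum]
  refine (abs_sum_le_sum_abs _ _).trans (sum_le_sum fun p _ => ?_)
  rw [abs_mul]
  calc |F p.1| * |G p.2| ≤ divisorFun i p.1 * (C * divisorFun j p.2) :=
        mul_le_mul (hF _) (hG _) (abs_nonneg _) (divisorFun_nonneg _ _)
    _ = _ := by ring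

lemma mul_apply_eq_zero_of_lt {F G : ArithmeticFunction ℝ} {A B : ℕ} (hF : ∀ n, A < n → F n = 0)
    (hG : ∀ n, B < n → G n = 0) {n : ℕ} (hn : A * B < n) : (F * G) n = 0 := by
  rw [ArithmeticFunction.mul_apply]
  refine sum_eq_zero fun p hp => ?_
  have hpn := (Nat.mem_divisorsAntidiagonal.1 hp).1
  by_cases h1 : A < p.1
  · rw [hF _ h1, zero_mul]
  by_cases h2 : B < p.2
  · rw [hG _ h2, mul_zero]
  have := Nat.mul_le_mul (not_lt.1 h1) (not_lt.1 h2)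
  omega

lemma pow_apply_eq_zero_of_lt {F : ArithmeticFunction ℝ} {U : ℕ} (hF : ∀ n, U < n → F n = 0)
    (j : ℕ) {n : ℕ} (hn : U ^ j < n) : (F ^ j) n = 0 := by
  induction j generalizing n with
  | zero =>
    rw [pow_zero] at hn ⊢
    rw [ArithmeticFunction.one_apply, if_neg hn.ne']
  | succ j ih =>
    rw [pow_succ] at hn ⊢
    exact mul_apply_eq_zero_of_lt (fun m hm => ih hm) hF hn

lemma mul_apply_eq_zero_of_le {F : ArithmeticFunction ℝ} (G : ArithmeticFunction ℝ) {U : ℕ}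
    (hF : ∀ n ≤ U, F n = 0) {n : ℕ} (hn : n ≤ U) : (F * G) n = 0 := by
  rw [ArithmeticFunction.mul_apply]
  refine sum_eq_zero fun p hp => ?_
  rw [hF p.1 ((Nat.divisor_le (Nat.fst_mem_divisors_of_mem_antidiagonal hp)).trans hn), zero_mul]

/-! ### Decomposition of `μ^k` -/

/-- The Möbius function with real values. -/
def realMoebius : ArithmeticFunction ℝ :=
  ((ArithmeticFunction.moebius : ArithmeticFunction ℤ) : ArithmeticFunction ℝ)

lemma realMoebius_apply (n : ℕ) : realMoebius n = (ArithmeticFunction.moebius n : ℝ) := by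
  simp [realMoebius]

lemma realMoebius_mul_divisorFun_one : realMoebius * divisorFun 1 = 1 := by
  rw [realMoebius, divisorFun, pow_one, ArithmeticFunction.coe_moebius_mul_coe_zeta]

lemma abs_realMoebius_le (n : ℕ) : |realMoebius n| ≤ divisorFun 1 n := by
  rcases eq_or_ne n 0 with rfl | hn
  · simp
  rw [divisorFun_one_apply hn, realMoebius_apply, ← Int.cast_abs]
  exact_mod_cast ArithmeticFunction.abs_moebius_le_one

lemma realMoebius_pow_apply (k n : ℕ) : (realMoebius ^ k) n = (moebiusConv k n : ℝ) := by
  rw [moebiusConv]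
  induction k generalizing n with
  | zero =>
    rw [pow_zero, pow_zero, ArithmeticFunction.one_apply, ArithmeticFunction.one_apply]
    split_ifs <;> simp
  | succ k ih =>
    rw [pow_succ, pow_succ, ArithmeticFunction.mul_apply, ArithmeticFunction.mul_apply]
    push_cast
    exact sum_congr rfl fun p _ => by rw [ih, realMoebius_apply]

/-- The part of the Möbius function supported on `n > U`. -/
def moebiusTail (U : ℕ) : ArithmeticFunction ℝ :=
  ⟨fun n => if n ≤ U then 0 else realMoebius n, by simp⟩

lemma moebiusTail_apply (U n : ℕ) : moebiusTail U n = if n ≤ U then 0 else realMoebius n := rfl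

lemma abs_moebiusTail_le (U n : ℕ) : |moebiusTail U n| ≤ divisorFun 1 n := by
  rw [moebiusTail_apply]
  split_ifs
  · simpa using divisorFun_nonneg 1 n
  · exact abs_realMoebius_le n

lemma arithmeticFunction_sub_apply (F G : ArithmeticFunction ℝ) (n : ℕ) :
    (F - G) n = F n - G n := by
  rw [eq_sub_iff_add_eq, ← ArithmeticFunction.add_apply, sub_add_cancel]

lemma realMoebius_sub_moebiusTail_apply (U n : ℕ) :
    (realMoebius - moebiusTail U) n = if n ≤ U then realMoebius n else 0 := by
  rw [arithmeticFunction_sub_apply, moebiusTail_apply]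
  split_ifs <;> simp

lemma abs_realMoebius_sub_moebiusTail_le (U n : ℕ) :
    |(realMoebius - moebiusTail U) n| ≤ divisorFun 1 n := by
  rw [realMoebius_sub_moebiusTail_apply]
  split_ifs
  · exact abs_realMoebius_le n
  · simpa using divisorFun_nonneg 1 n

lemma natCast_mul_apply (m : ℕ) (F : ArithmeticFunction ℝ) (n : ℕ) :
    ((m : ArithmeticFunction ℝ) * F) n = m * F n := by
  rw [← nsmul_eq_mul, ← Nat.cast_smul_eq_nsmul ℝ, ArithmeticFunction.smul_map, smul_eq_mul]

/-- The binomial expansion of `(μ - g)^k` modulo `g²`, where `g` is the tail of `μ`. -/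
lemma exists_pow_eq_add_sq_mul (U j : ℕ) : ∃ R : ArithmeticFunction ℝ,
    (realMoebius - moebiusTail U) ^ (j + 2) = realMoebius ^ (j + 2) -
      ((j + 2 : ℕ) : ArithmeticFunction ℝ) * (realMoebius ^ (j + 1) * moebiusTail U) +
      moebiusTail U ^ 2 * R ∧
    ∀ n, |R n| ≤ (j + 2 : ℝ) ^ 2 * divisorFun j n := by
  induction j with
  | zero =>
    refine ⟨1, by push_cast; ring, fun n => ?_⟩
    rw [← divisorFun_zero, abs_of_nonneg (divisorFun_nonneg _ _)]
    push_cast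
    linarith [divisorFun_nonneg 0 n]
  | succ j ih =>
    obtain ⟨R, hR, hb⟩ := ih
    refine ⟨(realMoebius - moebiusTail U) * R +
      ((j + 2 : ℕ) : ArithmeticFunction ℝ) * realMoebius ^ (j + 1), ?_, fun n => ?_⟩
    · rw [show j + 1 + 2 = (j + 2) + 1 by ring, pow_succ', hR]
      push_cast
      ring
    · have h1 := abs_mul_apply_le_divisorFun (abs_realMoebius_sub_moebiusTail_le U) hb n
      have h2 := abs_pow_apply_le abs_realMoebius_le (j + 1) n
      have h3 : (((j + 2 : ℕ) : ArithmeticFunction ℝ) * realMoebius ^ (j + 1)) n =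
          (j + 2) * (realMoebius ^ (j + 1)) n := by
        rw [natCast_mul_apply]; push_cast; ring
      rw [add_comm 1 j] at h1
      rw [ArithmeticFunction.add_apply, h3]
      refine (abs_add_le _ _).trans ?_
      rw [abs_mul, abs_of_nonneg (by positivity : (0 : ℝ) ≤ j + 2)]
      push_cast
      nlinarith [divisorFun_nonneg (j + 1) n, Nat.cast_nonneg (α := ℝ) j]

/-- The combinatorial identity behind the theorem.  Write `f` for the part of `μ` on `n ≤ U`, and
`g = μ - f`.  Both `f^k` and `f^(k+1) * 1` are combinations of `μ^k` and `μ^(k-1) * g`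
modulo `g²`, so that `μ^k` is a combination of them modulo `g²`. -/
lemma exists_moebius_pow_decomposition (U : ℕ) {k : ℕ} (hk : 2 ≤ k) :
    ∃ H : ArithmeticFunction ℝ,
    realMoebius ^ k =
      ((k + 1 : ℕ) : ArithmeticFunction ℝ) * (realMoebius - moebiusTail U) ^ k -
      (k : ArithmeticFunction ℝ) *
        ((realMoebius - moebiusTail U) ^ (k + 1) * divisorFun 1) +
      moebiusTail U * (moebiusTail U * H) ∧
    ∀ n, |(moebiusTail U * H) n| ≤ 2 * k * (k + 1 : ℝ) ^ 2 * divisorFun (k + 1) n := by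
  obtain ⟨j, rfl⟩ : ∃ j, k = j + 2 := ⟨k - 2, by omega⟩
  obtain ⟨R, hR, hb⟩ := exists_pow_eq_add_sq_mul U j
  obtain ⟨R', hR', hb'⟩ := exists_pow_eq_add_sq_mul U (j + 1)
  have hz := realMoebius_mul_divisorFun_one
  refine ⟨((j + 2 : ℕ) : ArithmeticFunction ℝ) * (divisorFun 1 * R') -
    ((j + 3 : ℕ) : ArithmeticFunction ℝ) * R, ?_, ?_⟩
  · rw [show j + 1 + 2 = j + 2 + 1 by ring] at hR'
    push_cast at hR hR' ⊢
    linear_combination -((j : ArithmeticFunction ℝ) + 3) * hR +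
      ((j : ArithmeticFunction ℝ) + 2) * divisorFun 1 * hR' +
      (((j : ArithmeticFunction ℝ) + 2) * realMoebius ^ (j + 2) -
        ((j : ArithmeticFunction ℝ) + 2) * ((j : ArithmeticFunction ℝ) + 3) *
        realMoebius ^ (j + 1) * moebiusTail U) * hz
  · intro n
    have hH : ∀ n, |(((j + 2 : ℕ) : ArithmeticFunction ℝ) * (divisorFun 1 * R') -
        ((j + 3 : ℕ) : ArithmeticFunction ℝ) * R) n| ≤
        2 * (j + 2 : ℕ) * ((j + 2 : ℕ) + 1 : ℝ) ^ 2 * divisorFun (j + 2) n := by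
      intro n
      have h1 := abs_mul_apply_le_divisorFun
        (fun n => (abs_of_nonneg (divisorFun_nonneg 1 n)).le) hb' n
      have h2 := (hb n).trans (mul_le_mul_of_nonneg_left
        (divisorFun_mono (show j ≤ j + 2 by omega) n) (by positivity))
      rw [show 1 + (j + 1) = j + 2 by ring] at h1
      rw [arithmeticFunction_sub_apply, natCast_mul_apply, natCast_mul_apply]
      refine (abs_sub _ _).trans ?_
      rw [abs_mul, abs_mul, Nat.abs_cast, Nat.abs_cast]
      have hd := divisorFun_nonneg (j + 2) n
      have hj := Nat.cast_nonneg (α := ℝ) j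
      push_cast at h1 h2 ⊢
      calc ((j : ℝ) + 2) * |(divisorFun 1 * R') n| + (j + 3) * |R n|
          ≤ (j + 2) * (((j : ℝ) + 1 + 2) ^ 2 * divisorFun (j + 2) n) +
            (j + 3) * ((j + 2 : ℝ) ^ 2 * divisorFun (j + 2) n) := by gcongr
        _ = ((j : ℝ) + 2) * (j + 3) * ((j + 3) + (j + 2)) * divisorFun (j + 2) n := by ring
        _ ≤ ((j : ℝ) + 2) * (j + 3) * (2 * (j + 3)) * divisorFun (j + 2) n := by
            gcongr; linarith
        _ = _ := by ring
    have := abs_mul_apply_le_divisorFun (abs_moebiusTail_le U) hH n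
    rwa [add_comm 1] at this

/-! ### The exponential sum over `μ^k` -/

/-- The bilinear part of `μ^k`.  The mean square of `g * H` is that of `d_(j+1)`, hence costs
`(j + 1)² - 1` powers of the logarithm; the bilinear bound costs three more. -/
lemma norm_sum_moebiusTail_mul_sq_le {α : ℝ} {a : ℤ} {q : ℕ} (hq : 0 < q)
    (ha : IsCoprime a (q : ℤ)) (hα : |α - a / q| ≤ 1 / (q : ℝ) ^ 2) {x U : ℕ} (hqx : q ≤ x)
    (hU : 0 < U) (j : ℕ) {H : ArithmeticFunction ℝ} {C : ℝ}
    (hH : ∀ n, |(moebiusTail U * H) n| ≤ C * divisorFun (j + 1) n) :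
    ‖∑ n ∈ Ioc 0 x, (moebiusTail U * (moebiusTail U * H)) n • expChar (n * α)‖ ^ 2 ≤
      84 * C ^ 2 * (1 + Real.log x) ^ ((j + 1) ^ 2 + 2) * x * ((x : ℝ) / q + q + x / U) := by
  have hx : 1 ≤ x := hq.trans_le hqx
  have hlog : 0 ≤ Real.log x := Real.log_natCast_nonneg x
  rw [sum_mul_smul (moebiusTail U) (moebiusTail U * H) (fun n => expChar (n * α))]
  simp only [Complex.real_smul]
  have htail0 : ∀ n ≤ U, moebiusTail U n = 0 := fun n hn => by rw [moebiusTail_apply, if_pos hn]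
  obtain ⟨e, he⟩ : ∃ e, (j + 1) * (j + 1) = e + 1 := ⟨j * j + 2 * j, by ring⟩
  have hb : ∀ N ≤ x, ∑ n ∈ Ioc 0 N, (moebiusTail U * H) n ^ 2 ≤
      (C ^ 2 * (1 + Real.log x) ^ e) * N := by
    intro N hN
    calc ∑ n ∈ Ioc 0 N, (moebiusTail U * H) n ^ 2
        ≤ ∑ n ∈ Ioc 0 N, C ^ 2 * divisorFun (e + 1) n := by
          refine sum_le_sum fun n _ => ?_
          rw [← he]
          calc (moebiusTail U * H) n ^ 2 ≤ (C * divisorFun (j + 1) n) ^ 2 := by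
                rw [← sq_abs]
                exact pow_le_pow_left₀ (abs_nonneg _) (hH n) 2
            _ = C ^ 2 * (divisorFun (j + 1) n * divisorFun (j + 1) n) := by ring
            _ ≤ _ := mul_le_mul_of_nonneg_left (divisorFun_mul_divisorFun_le _ _ _) (sq_nonneg _)
      _ ≤ C ^ 2 * (N * (1 + Real.log N) ^ e) := by
          rw [← mul_sum]
          exact mul_le_mul_of_nonneg_left (sum_divisorFun_le e N) (sq_nonneg _)
      _ ≤ C ^ 2 * (N * (1 + Real.log x) ^ e) := by
          have h0 : 0 ≤ Real.log N := Real.log_natCast_nonneg N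
          rcases Nat.eq_zero_or_pos N with rfl | hN0
          · simp
          gcongr
      _ = _ := by ring
  have := norm_bilinear_sq_le hq ha hα hqx hU (moebiusTail U)
    (moebiusTail U * H : ArithmeticFunction ℝ)
    (fun m => ?_) htail0 (fun n hn => mul_apply_eq_zero_of_le H htail0 hn) (by positivity) hb
  · refine this.trans (le_of_eq ?_)
    rw [show (j + 1) ^ 2 + 2 = e + 3 by rw [sq, he]]
    ring
  · rcases eq_or_ne m 0 with rfl | hm
    · simp
    · exact (abs_moebiusTail_le U m).trans_eq (divisorFun_one_apply hm)

/-- The part of `μ^k` with a smooth variable.  By Cauchy's inequality the divisor-bounded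
coefficients separate from the kernel sum. -/
lemma norm_sum_mul_divisorFun_one_sq_le {α : ℝ} {a : ℤ} {q : ℕ} (hq : 0 < q)
    (ha : IsCoprime a (q : ℤ)) (hα : |α - a / q| ≤ 1 / (q : ℝ) ^ 2) {x N : ℕ} (hqx : q ≤ x)
    (hN : N ≤ x) (j : ℕ) {F : ArithmeticFunction ℝ} (hF : ∀ n, |F n| ≤ divisorFun j n)
    (hFN : ∀ n, N < n → F n = 0) :
    ‖∑ n ∈ Ioc 0 x, (F * divisorFun 1) n • expChar (n * α)‖ ^ 2 ≤
      32 * (1 + Real.log x) ^ (j ^ 2 + 1) * x * ((x : ℝ) / q + N + q) := by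
  have hx : 0 < x := hq.trans_le hqx
  have hx' : (0 : ℝ) < x := by exact_mod_cast hx
  have hlog : 0 ≤ Real.log x := Real.log_natCast_nonneg x
  set K : ℕ → ℝ := fun m => geomKernel (x / m) (α * m) with hK
  have hK0 : ∀ m, 0 ≤ K m := fun m => geomKernel_nonneg (by positivity) _
  rw [sum_mul_smul F (divisorFun 1) (fun n => expChar (n * α))]
  have hinner : ∀ m ∈ Ioc 0 N,
      ‖∑ k ∈ Ioc 0 (x / m), divisorFun 1 k • expChar ((m * k : ℕ) * α)‖ ≤ K m := by
    intro m hm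
    have hm0 : 0 < m := (mem_Ioc.1 hm).1
    have hm' : (0 : ℝ) < m := by exact_mod_cast hm0
    have e : ∑ k ∈ Ioc 0 (x / m), divisorFun 1 k • expChar ((m * k : ℕ) * α) =
        ∑ k ∈ Ico 1 (x / m + 1), expChar (k * (α * m)) := by
      refine sum_congr (by ext; simp only [mem_Ioc, mem_Ico]; generalize x / m = t; omega) fun k hk => ?_
      have hk0 : k ≠ 0 := by have := (mem_Ico.1 hk).1; omega
      rw [divisorFun_one_apply hk0, one_smul]
      push_cast
      ring_nf
    rw [e]
    refine norm_sum_expChar_le (by positivity) (Nat.le_add_left _ _) ?_ _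
    have : ((x / m : ℕ) : ℝ) ≤ x / m := Nat.cast_div_le
    push_cast
    linarith
  have h1 : ‖∑ m ∈ Ioc 0 x, F m • ∑ k ∈ Ioc 0 (x / m), divisorFun 1 k • expChar ((m * k : ℕ) * α)‖
      ≤ ∑ m ∈ Ioc 0 N, divisorFun j m * √(K m) * √(K m) := by
    rw [← sum_subset (Ioc_subset_Ioc_right hN) (fun m hm hm' => ?_)]
    · refine (norm_sum_le _ _).trans (sum_le_sum fun m hm => ?_)
      rw [norm_smul, mul_assoc, Real.mul_self_sqrt (hK0 m), Real.norm_eq_abs]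
      exact mul_le_mul (hF m) (hinner m hm) (norm_nonneg _) (divisorFun_nonneg _ _)
    · simp only [mem_Ioc, not_and, not_le] at hm hm'
      rw [hFN m (hm' hm.1), zero_smul]
  have h2 : ∑ m ∈ Ioc 0 N, (divisorFun j m * √(K m)) ^ 2 ≤
      x * (1 + Real.log x) ^ (j ^ 2) := by
    calc ∑ m ∈ Ioc 0 N, (divisorFun j m * √(K m)) ^ 2
        ≤ ∑ m ∈ Ioc 0 N, x * (divisorFun (j ^ 2) m * (1 / m)) := by
          refine sum_le_sum fun m hm => ?_
          have hm' : (0 : ℝ) < m := by exact_mod_cast (mem_Ioc.1 hm).1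
          rw [mul_pow, Real.sq_sqrt (hK0 m), sq, sq j]
          calc divisorFun j m * divisorFun j m * K m
              ≤ divisorFun (j * j) m * (x / m) :=
                mul_le_mul (divisorFun_mul_divisorFun_le _ _ _)
                  (geomKernel_le (by positivity) _) (hK0 m) (divisorFun_nonneg _ _)
            _ = _ := by ring
      _ ≤ ∑ m ∈ Ioc 0 x, x * (divisorFun (j ^ 2) m * (1 / m)) :=
          sum_le_sum_of_subset_of_nonneg (Ioc_subset_Ioc_right hN) fun m _ _ =>
            mul_nonneg hx'.le (mul_nonneg (divisorFun_nonneg _ _) (by positivity))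
      _ ≤ _ := by
          rw [← mul_sum]
          exact mul_le_mul_of_nonneg_left (sum_divisorFun_div_le _ _) hx'.le
  have h3 : ∑ m ∈ Ioc 0 N, √(K m) ^ 2 ≤ 32 * ((x : ℝ) / q + N + q) * (1 + Real.log x) := by
    rw [sum_congr rfl fun m _ => Real.sq_sqrt (hK0 m)]
    exact sum_geomKernel_div_le hq ha hα hqx hN
  calc _ ≤ (∑ m ∈ Ioc 0 N, divisorFun j m * √(K m) * √(K m)) ^ 2 :=
        pow_le_pow_left₀ (norm_nonneg _) h1 2
    _ ≤ (∑ m ∈ Ioc 0 N, (divisorFun j m * √(K m)) ^ 2) * ∑ m ∈ Ioc 0 N, √(K m) ^ 2 :=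
        sum_mul_sq_le_sq_mul_sq _ _ _
    _ ≤ (x * (1 + Real.log x) ^ (j ^ 2)) *
          (32 * ((x : ℝ) / q + N + q) * (1 + Real.log x)) := by
        refine mul_le_mul h2 h3 (sum_nonneg fun _ _ => by positivity) (by positivity)
    _ = _ := by ring

lemma norm_sum_smul_expChar_le {F : ArithmeticFunction ℝ} {j : ℕ}
    (hF : ∀ n, |F n| ≤ divisorFun (j + 1) n) {x N : ℕ} (hN : N ≤ x)
    (hFN : ∀ n, N < n → F n = 0) (α : ℝ) :
    ‖∑ n ∈ Ioc 0 x, F n • expChar (n * α)‖ ≤ N * (1 + Real.log N) ^ j := by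
  rw [← sum_subset (Ioc_subset_Ioc_right hN) (fun m hm hm' => ?_)]
  · refine (norm_sum_le _ _).trans (le_trans (sum_le_sum fun m _ => ?_) (sum_divisorFun_le j N))
    rw [norm_smul, norm_expChar, mul_one]
    exact hF m
  · simp only [mem_Ioc, not_and, not_le] at hm hm'
    rw [hFN m (hm' hm.1), zero_smul]

lemma moebiusExpSum_eq (k : ℕ) (X α : ℝ) :
    moebiusExpSum k X α = ∑ n ∈ Ioc 0 ⌊X⌋₊, (realMoebius ^ k) n • expChar (n * α) := by
  rw [moebiusExpSum]
  refine sum_congr (by ext; simp; omega) fun n _ => ?_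
  rw [realMoebius_pow_apply, Complex.real_smul]
  push_cast
  rfl

/-- The trivial bound. -/
lemma norm_moebiusExpSum_le {k : ℕ} (hk : 1 ≤ k) {X : ℝ} (hX : 1 ≤ X) (α : ℝ) :
    ‖moebiusExpSum k X α‖ ≤ X * (1 + Real.log X) ^ (k - 1) := by
  obtain ⟨j, rfl⟩ : ∃ j, k = j + 1 := ⟨k - 1, by omega⟩
  have hx : (1 : ℝ) ≤ ⌊X⌋₊ := by exact_mod_cast Nat.floor_pos.2 hX
  have hxX : (⌊X⌋₊ : ℝ) ≤ X := Nat.floor_le (by linarith)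
  rw [moebiusExpSum_eq, Nat.add_sub_cancel]
  have hlog : 0 ≤ Real.log ⌊X⌋₊ := Real.log_nonneg hx
  have h : ‖∑ n ∈ Ioc 0 ⌊X⌋₊, (realMoebius ^ (j + 1)) n • expChar (n * α)‖ ≤
      ⌊X⌋₊ * (1 + Real.log ⌊X⌋₊) ^ j := by
    refine (norm_sum_le _ _).trans (le_trans (sum_le_sum fun m _ => ?_) (sum_divisorFun_le j _))
    rw [norm_smul, norm_expChar, mul_one]
    exact abs_pow_apply_le abs_realMoebius_le _ m
  refine h.trans ?_
  gcongr

/-- The bound delivered by the decomposition of `μ^k`, with the cut-off parameter `U` left free. -/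
lemma norm_moebiusExpSum_sq_le {k : ℕ} (hk : 2 ≤ k) {α : ℝ} {a : ℤ} {q : ℕ} (hq : 0 < q)
    (ha : IsCoprime a (q : ℤ)) (hα : |α - a / q| ≤ 1 / (q : ℝ) ^ 2) {X : ℝ} {U : ℕ}
    (hqX : (q : ℝ) ≤ X) (hU : 0 < U) (hUX : (U : ℝ) ^ (k + 1) ≤ X) :
    ‖moebiusExpSum k X α‖ ^ 2 ≤
      3 * ((k + 1) ^ 2 + 32 * k ^ 2 + 84 * (2 * k * (k + 1) ^ 2) ^ 2) *
        (1 + Real.log X) ^ ((k + 1) ^ 2 + 2) * X * (X / q + q + X / U + U ^ (k + 1)) := by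
  have hq' : (0 : ℝ) < q := by exact_mod_cast hq
  have hU' : (0 : ℝ) < U := by exact_mod_cast hU
  have hX0 : 0 < X := hq'.trans_le hqX
  rw [moebiusExpSum_eq]
  have hqx : q ≤ ⌊X⌋₊ := Nat.le_floor hqX
  have hUx : U ^ (k + 1) ≤ ⌊X⌋₊ := Nat.le_floor (by push_cast; exact hUX)
  have hxX : (⌊X⌋₊ : ℝ) ≤ X := Nat.floor_le hX0.le
  have hx0 : (0 : ℝ) < ⌊X⌋₊ := by exact_mod_cast hq.trans_le hqx
  have hlogX : Real.log ⌊X⌋₊ ≤ Real.log X := Real.log_le_log hx0 hxX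
  generalize ⌊X⌋₊ = x at hqx hUx hxX hx0 hlogX ⊢
  have hlog : 0 ≤ Real.log x := Real.log_natCast_nonneg x
  set l := 1 + Real.log X with hl
  have hl1 : 1 ≤ l := by linarith
  obtain ⟨H, hdec, hH⟩ := exists_moebius_pow_decomposition U hk
  set f := realMoebius - moebiusTail U with hf
  set g := moebiusTail U with hg
  have hfd := abs_realMoebius_sub_moebiusTail_le U
  have hfU : ∀ n, U < n → f n = 0 := fun n hn => by
    rw [hf, realMoebius_sub_moebiusTail_apply, if_neg hn.not_ge]
  set Y := l ^ ((k + 1) ^ 2 + 2) * X * (X / q + q + X / U + U ^ (k + 1)) with hY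
  set E₁ := ∑ n ∈ Ioc 0 x, (f ^ k) n • expChar (n * α)
  set E₂ := ∑ n ∈ Ioc 0 x, (f ^ (k + 1) * divisorFun 1) n • expChar (n * α)
  set E₃ := ∑ n ∈ Ioc 0 x, (g * (g * H)) n • expChar (n * α)
  have hS : ∑ n ∈ Ioc 0 x, (realMoebius ^ k) n • expChar (n * α) =
      ((k + 1 : ℝ) • E₁ - (k : ℝ) • E₂) + E₃ := by
    rw [smul_sum, smul_sum, ← sum_sub_distrib, ← sum_add_distrib]
    refine sum_congr rfl fun n _ => ?_
    rw [hdec, ArithmeticFunction.add_apply, arithmeticFunction_sub_apply, natCast_mul_apply,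
      natCast_mul_apply, add_smul, sub_smul, mul_smul, mul_smul]
    push_cast
    rfl
  have hUk : U ^ k ≤ x := (Nat.pow_le_pow_right hU (by omega)).trans hUx
  have h1 : ‖E₁‖ ^ 2 ≤ Y := by
    obtain ⟨j, hj⟩ : ∃ j, k = j + 1 := ⟨k - 1, by omega⟩
    have hb := norm_sum_smul_expChar_le (F := f ^ k) (j := j)
      (fun n => hj ▸ abs_pow_apply_le hfd k n) hUk
      (fun n hn => pow_apply_eq_zero_of_lt hfU k hn) α
    have hUk0 : (0 : ℝ) < ((U ^ k : ℕ) : ℝ) := by positivity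
    have hlU : Real.log ((U ^ k : ℕ) : ℝ) ≤ Real.log X :=
      Real.log_le_log hUk0 (le_trans (by exact_mod_cast hUk) hxX)
    have hlU0 : 0 ≤ Real.log ((U ^ k : ℕ) : ℝ) := Real.log_natCast_nonneg _
    have hUk1 : ((U ^ k : ℕ) : ℝ) ≤ X := le_trans (by exact_mod_cast hUk) hxX
    have hUk2 : ((U ^ k : ℕ) : ℝ) ≤ U ^ (k + 1) := by
      exact_mod_cast Nat.pow_le_pow_right hU (by omega)
    calc ‖E₁‖ ^ 2 ≤ (((U ^ k : ℕ) : ℝ) * l ^ j) ^ 2 := by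
          refine pow_le_pow_left₀ (norm_nonneg _) (hb.trans ?_) 2
          gcongr
          linarith
      _ = l ^ (2 * j) * ((U ^ k : ℕ) : ℝ) * ((U ^ k : ℕ) : ℝ) := by ring
      _ ≤ l ^ ((k + 1) ^ 2 + 2) * X * U ^ (k + 1) := by
          gcongr ?_ * ?_ * ?_
          exact pow_le_pow_right₀ hl1 (by rw [hj]; nlinarith)
      _ ≤ Y := by
          rw [hY]
          gcongr
          have : 0 ≤ X / q + q + X / U := by positivity
          linarith
  have h2 : ‖E₂‖ ^ 2 ≤ 32 * Y := by
    refine (norm_sum_mul_divisorFun_one_sq_le hq ha hα hqx hUx (k + 1)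
      (abs_pow_apply_le hfd (k + 1))
      (fun n hn => pow_apply_eq_zero_of_lt hfU (k + 1) hn)).trans ?_
    rw [hY, ← mul_assoc, ← mul_assoc]
    have h : (1 + Real.log x) ^ ((k + 1) ^ 2 + 1) ≤ l ^ ((k + 1) ^ 2 + 2) :=
      (pow_le_pow_left₀ (by linarith) (by linarith) _).trans
        (pow_le_pow_right₀ hl1 (by omega))
    gcongr ?_ * ?_ * ?_
    · gcongr
    · push_cast
      have h3 : (x : ℝ) / q ≤ X / q := by gcongr
      have h4 : 0 ≤ X / U := by positivity
      linarith
  have h3 : ‖E₃‖ ^ 2 ≤ 84 * (2 * k * (k + 1) ^ 2) ^ 2 * Y := by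
    refine (norm_sum_moebiusTail_mul_sq_le hq ha hα hqx hU k hH).trans ?_
    rw [hY, ← mul_assoc, ← mul_assoc]
    gcongr ?_ * ?_ * ?_
    · gcongr
      linarith
    · have h3 : (x : ℝ) / q ≤ X / q := by gcongr
      have h4 : (x : ℝ) / U ≤ X / U := by gcongr
      have h5 : 0 ≤ (U : ℝ) ^ (k + 1) := by positivity
      linarith
  rw [hS]
  have htri : ‖((k + 1 : ℝ) • E₁ - (k : ℝ) • E₂) + E₃‖ ≤ (k + 1) * ‖E₁‖ + k * ‖E₂‖ + ‖E₃‖ := by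
    refine (norm_add_le _ _).trans (add_le_add ((norm_sub_le _ _).trans (le_of_eq ?_)) le_rfl)
    rw [norm_smul, norm_smul, Real.norm_of_nonneg (by positivity : (0 : ℝ) ≤ k + 1),
      Real.norm_of_nonneg (by positivity : (0 : ℝ) ≤ (k : ℝ))]
  calc _ ≤ ((k + 1) * ‖E₁‖ + k * ‖E₂‖ + ‖E₃‖) ^ 2 := pow_le_pow_left₀ (norm_nonneg _) htri 2
    _ ≤ 3 * (((k + 1) * ‖E₁‖) ^ 2 + (k * ‖E₂‖) ^ 2 + ‖E₃‖ ^ 2) := by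
        nlinarith [sq_nonneg ((k + 1) * ‖E₁‖ - k * ‖E₂‖), sq_nonneg ((k + 1) * ‖E₁‖ - ‖E₃‖),
          sq_nonneg (k * ‖E₂‖ - ‖E₃‖)]
    _ ≤ 3 * ((k + 1) ^ 2 * Y + k ^ 2 * (32 * Y) + 84 * (2 * k * (k + 1) ^ 2) ^ 2 * Y) := by
        rw [mul_pow, mul_pow]
        gcongr
    _ = _ := by rw [hY]; ring

/-! ### The exponents -/

lemma seqA_succ_eq (m : ℕ) : seqA (m + 1) = 1 - 1 / (2 * 3 ^ (m + 1) - 1) := by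
  induction m with
  | zero => norm_num [seqA]
  | succ m ih =>
    have h : (1 : ℝ) ≤ 3 ^ (m + 1) := one_le_pow₀ (by norm_num)
    have h1 : (2 * 3 ^ (m + 1) - 1 : ℝ) ≠ 0 := by linarith
    have h2 : (2 * 3 ^ (m + 1 + 1) - 1 : ℝ) ≠ 0 := by rw [pow_succ]; linarith
    have h3 : 5 - 2 * (1 - 1 / (2 * 3 ^ (m + 1) - 1 : ℝ)) ≠ 0 := by
      have : 0 < 1 / (2 * 3 ^ (m + 1) - 1 : ℝ) := by apply one_div_pos.2; linarith
      linarith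
    rw [seqA, ih, div_eq_iff h3]
    field_simp
    ring

lemma seqB_succ_eq (m : ℕ) : seqB (m + 1) = 1 / (2 * 3 ^ m) := by
  induction m with
  | zero => norm_num [seqB]
  | succ m ih =>
    rw [seqB, ih, pow_succ]
    field_simp

lemma seqC_succ_eq (m : ℕ) : seqC (m + 1) = 1 - 1 / (3 ^ (m + 1) - 1) := by
  induction m with
  | zero => norm_num [seqC]
  | succ m ih =>
    have h : (3 : ℝ) ≤ 3 ^ (m + 1) := by
      rw [pow_succ]
      linarith [one_le_pow₀ (n := m) (by norm_num : (1 : ℝ) ≤ 3)]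
    have h1 : (3 ^ (m + 1) - 1 : ℝ) ≠ 0 := by linarith
    have h2 : (3 ^ (m + 1 + 1) - 1 : ℝ) ≠ 0 := by rw [pow_succ]; linarith
    have h3 : 5 - 2 * (1 - 1 / (3 ^ (m + 1) - 1 : ℝ)) ≠ 0 := by
      have : 0 < 1 / (3 ^ (m + 1) - 1 : ℝ) := by apply one_div_pos.2; linarith
      linarith
    rw [seqC, ih, div_eq_iff h3]
    field_simp
    ring

lemma seqB_mem {k : ℕ} (hk : 1 ≤ k) : 0 ≤ seqB k ∧ seqB k * 2 ≤ 1 := by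
  obtain ⟨m, rfl⟩ : ∃ m, k = m + 1 := ⟨k - 1, by omega⟩
  have h : (1 : ℝ) ≤ 3 ^ m := one_le_pow₀ (by norm_num)
  rw [seqB_succ_eq]
  refine ⟨by positivity, ?_⟩
  rw [div_mul_eq_mul_div, div_le_one (by positivity)]
  linarith

lemma seqC_mem {k : ℕ} (hk : 1 ≤ k) : 0 ≤ 1 - seqC k ∧ (1 - seqC k) * 2 ≤ 1 := by
  obtain ⟨m, rfl⟩ : ∃ m, k = m + 1 := ⟨k - 1, by omega⟩
  have h : (1 : ℝ) ≤ 3 ^ m := one_le_pow₀ (by norm_num)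
  rw [seqC_succ_eq, sub_sub_cancel, pow_succ]
  refine ⟨one_div_nonneg.2 (by linarith), ?_⟩
  rw [div_mul_eq_mul_div, div_le_one (by linarith)]
  linarith

/-! ### The bound for a fixed `k` -/

/-- The cut-off `U ≍ X^(2(1 - a_k))` balances the decomposition of `μ^k` at `X^(a_k)`. -/
lemma exists_norm_moebiusExpSum_sq_le {k : ℕ} (hk : 2 ≤ k) : ∃ C : ℝ, 1 ≤ C ∧
    ∀ (X α : ℝ) (a : ℤ) (q : ℕ), 1 ≤ X → 0 < q → IsCoprime a (q : ℤ) →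
      |α - (a : ℝ) / (q : ℝ)| ≤ 1 / (q : ℝ) ^ 2 → (q : ℝ) ≤ X →
      ‖moebiusExpSum k X α‖ ^ 2 ≤ C * (1 + Real.log X) ^ ((k + 1) ^ 2 + 2) *
        (X ^ 2 * (1 / q) + X ^ 2 * (q / X) + (X ^ seqA k) ^ 2) := by
  set C₀ : ℝ := 3 * ((k + 1) ^ 2 + 32 * k ^ 2 + 84 * (2 * k * (k + 1) ^ 2) ^ 2) with hC₀
  have hk0 : (2 : ℝ) ≤ k := by exact_mod_cast hk
  have hC₀1 : 1 ≤ C₀ := by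
    have h1 : (1 : ℝ) ≤ (k + 1) ^ 2 := by nlinarith
    have h2 : (0 : ℝ) ≤ 32 * k ^ 2 + 84 * (2 * k * (k + 1) ^ 2) ^ 2 := by positivity
    linarith
  refine ⟨3 * C₀, by linarith, fun X α a q hX hq ha hα hqX => ?_⟩
  have hX0 : 0 < X := by linarith
  set δ : ℝ := 1 - seqA k with hδ
  obtain ⟨m, rfl⟩ : ∃ m, k = m + 1 := ⟨k - 1, by omega⟩
  have hδeq : δ = 1 / (2 * 3 ^ (m + 1) - 1) := by rw [hδ, seqA_succ_eq]; ring
  -- `2 (k + 2) ≤ 2 * 3 ^ k - 1`, in the form needed for `U ^ (k + 1) ≤ X ^ (1 - 2 δ)`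
  have hpow : 2 * ((m + 1 : ℕ) : ℝ) + 4 ≤ 2 * 3 ^ (m + 1) - 1 := by
    have hb := one_add_mul_le_pow (a := (2 : ℝ)) (by norm_num) (m + 1)
    norm_num at hb hk0 ⊢
    linarith
  have hD : (0 : ℝ) < 2 * 3 ^ (m + 1) - 1 := by linarith
  have hδ0 : 0 < δ := by rw [hδeq]; positivity
  have hδ1 : (2 * ((m + 1 : ℕ) : ℝ) + 4) * δ ≤ 1 := by
    rw [hδeq, mul_one_div, div_le_one hD]
    exact hpow
  have hV1 : 1 ≤ X ^ (2 * δ) := Real.one_le_rpow hX (by linarith)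
  set U := ⌊X ^ (2 * δ)⌋₊ with hU
  have hUpos : 0 < U := Nat.floor_pos.2 hV1
  have hU1 : (1 : ℝ) ≤ U := by exact_mod_cast hUpos
  have hUle : (U : ℝ) ≤ X ^ (2 * δ) := Nat.floor_le (by linarith)
  have hUge : X ^ (2 * δ) ≤ 2 * U := by
    have := Nat.lt_floor_add_one (X ^ (2 * δ))
    rw [← hU] at this
    linarith
  have hUpow : (U : ℝ) ^ (m + 1 + 1) ≤ X ^ (1 - 2 * δ) := by
    calc (U : ℝ) ^ (m + 1 + 1) ≤ (X ^ (2 * δ)) ^ (m + 1 + 1) := by gcongr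
      _ = X ^ (2 * δ * ((m + 1 + 1 : ℕ) : ℝ)) := by rw [Real.rpow_mul_natCast hX0.le]
      _ ≤ X ^ (1 - 2 * δ) := by
          refine Real.rpow_le_rpow_of_exponent_le hX ?_
          push_cast at hδ1 ⊢
          linarith
  have hXU : X / U ≤ 2 * X ^ (1 - 2 * δ) := by
    rw [Real.rpow_sub hX0, Real.rpow_one, div_le_iff₀ (by linarith), ← mul_div_assoc,
      div_mul_eq_mul_div, le_div_iff₀ (by linarith)]
    nlinarith
  have hmain := norm_moebiusExpSum_sq_le hk hq ha hα hqX hUpos (hUpow.trans (by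
    refine (Real.rpow_le_rpow_of_exponent_le hX (show 1 - 2 * δ ≤ 1 by linarith)).trans ?_
    rw [Real.rpow_one]))
  have hXa : X * X ^ (1 - 2 * δ) = (X ^ seqA (m + 1)) ^ 2 := by
    rw [← Real.rpow_mul_natCast hX0.le, ← Real.rpow_one_add' hX0.le]
    · congr 1
      rw [hδ]; push_cast; ring
    · have : (0 : ℝ) ≤ ((m + 1 : ℕ) : ℝ) * δ := by positivity
      linarith
  have hl : 0 ≤ 1 + Real.log X := by linarith [Real.log_nonneg hX]
  refine hmain.trans ?_
  rw [← hC₀]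
  calc C₀ * (1 + Real.log X) ^ ((m + 1 + 1) ^ 2 + 2) * X * (X / q + q + X / U + U ^ (m + 1 + 1))
      ≤ C₀ * (1 + Real.log X) ^ ((m + 1 + 1) ^ 2 + 2) * X *
          (X / q + q + 2 * X ^ (1 - 2 * δ) + X ^ (1 - 2 * δ)) := by gcongr
    _ = C₀ * (1 + Real.log X) ^ ((m + 1 + 1) ^ 2 + 2) *
          (X ^ 2 * (1 / q) + X ^ 2 * (q / X) + 3 * (X * X ^ (1 - 2 * δ))) := by
        field_simp
        ring
    _ ≤ C₀ * (1 + Real.log X) ^ ((m + 1 + 1) ^ 2 + 2) *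
          (3 * (X ^ 2 * (1 / q) + X ^ 2 * (q / X) + (X ^ seqA (m + 1)) ^ 2)) := by
        rw [hXa]
        gcongr
        have h1 : 0 ≤ X ^ 2 * (1 / (q : ℝ)) := by positivity
        have h2 : 0 ≤ X ^ 2 * ((q : ℝ) / X) := by positivity
        linarith
    _ = _ := by ring

/-- Interpolation between a trivial bound `S ≤ X l^r` and a bound for `S²` that saves `y`: giving
up part of the saving lowers the power of `l`. -/
lemma le_mul_rpow_of_sq_le {S X l y C b : ℝ} {r E p n : ℕ} (hS : 0 ≤ S) (hX : 0 ≤ X) (hl : 1 ≤ l)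
    (hy : 0 < y) (hy1 : y ≤ 1) (hC : 1 ≤ C) (htriv : S ≤ X * l ^ r)
    (hsq : S ^ 2 ≤ C * l ^ E * (X ^ 2 * y)) (hn : 2 ≤ n) (hexp : (n - 2) * r + E ≤ p * n)
    (hb : b * n ≤ 1) : S ≤ C * (X * l ^ p * y ^ b) := by
  obtain ⟨j, rfl⟩ : ∃ j, n = j + 2 := ⟨n - 2, by omega⟩
  rw [Nat.add_sub_cancel] at hexp
  have hl0 : 0 ≤ l := by linarith
  refine (pow_le_pow_iff_left₀ hS (by positivity) (show j + 2 ≠ 0 by omega)).1 ?_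
  have hyb : y ≤ (y ^ b) ^ (j + 2) := by
    rw [← Real.rpow_mul_natCast hy.le]
    calc y = y ^ (1 : ℝ) := (Real.rpow_one y).symm
      _ ≤ _ := Real.rpow_le_rpow_of_exponent_ge hy hy1 hb
  calc S ^ (j + 2) = S ^ j * S ^ 2 := pow_add _ _ _
    _ ≤ (X * l ^ r) ^ j * (C * l ^ E * (X ^ 2 * y)) := by gcongr
    _ = C * l ^ (j * r + E) * (X ^ (j + 2) * y) := by ring
    _ ≤ C ^ (j + 2) * l ^ (p * (j + 2)) * (X ^ (j + 2) * (y ^ b) ^ (j + 2)) := by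
        gcongr
        exact le_self_pow₀ hC (by omega)
    _ = _ := by ring

/-- Powers of the logarithm are absorbed by `X ^ ε`. -/
lemma exists_one_add_log_pow_le (n : ℕ) {ε : ℝ} (hε : 0 < ε) :
    ∃ C : ℝ, 1 ≤ C ∧ ∀ X : ℝ, 1 ≤ X → (1 + Real.log X) ^ n ≤ C * X ^ ε := by
  set η := ε / (n + 1) with hη
  have hη0 : 0 < η := by positivity
  refine ⟨(1 + 1 / η) ^ n, one_le_pow₀ (by simp [hη0.le]), fun X hX => ?_⟩
  have hX0 : 0 < X := by linarith
  have h1 : 1 ≤ X ^ η := Real.one_le_rpow hX hη0.le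
  have h2 := Real.log_le_rpow_div hX0.le hη0
  have h3 : 0 ≤ Real.log X := Real.log_nonneg hX
  calc (1 + Real.log X) ^ n ≤ ((1 + 1 / η) * X ^ η) ^ n := by
        gcongr
        rw [add_mul, one_mul, one_div_mul_eq_div]
        linarith
    _ = (1 + 1 / η) ^ n * X ^ (η * n) := by rw [mul_pow, Real.rpow_mul_natCast hX0.le]
    _ ≤ (1 + 1 / η) ^ n * X ^ ε := by
        gcongr
        rw [hη, div_mul_eq_mul_div, div_le_iff₀ (by positivity)]
        nlinarith

lemma one_add_log_le {X : ℝ} (hX : 2 ≤ X) : 1 + Real.log X ≤ 3 * Real.log X := by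
  have h1 := Real.log_le_log (by norm_num) hX
  have h2 := Real.log_two_gt_d9
  linarith

/-- For fixed `k`, any exponents `b`, `c` and any power `p` of the logarithm reached by
interpolation with weights `2 / n₁`, `2 / n₂` are admissible. -/
lemma exists_norm_moebiusExpSum_le {k : ℕ} (hk : 2 ≤ k) {p n₁ n₂ : ℕ} {b c : ℝ} (hp : k - 1 ≤ p)
    (hn₁ : 2 ≤ n₁) (hn₂ : 2 ≤ n₂) (he₁ : (n₁ - 2) * (k - 1) + ((k + 1) ^ 2 + 2) ≤ p * n₁)
    (he₂ : (n₂ - 2) * (k - 1) + ((k + 1) ^ 2 + 2) ≤ p * n₂) (hb : b * n₁ ≤ 1)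
    (hc0 : 0 ≤ 1 - c) (hc : (1 - c) * n₂ ≤ 1) {ε : ℝ} (hε : 0 < ε) : ∃ C : ℝ, 0 < C ∧
    ∀ (X α : ℝ) (a : ℤ) (q : ℕ), 2 ≤ X → 0 < q → IsCoprime a (q : ℤ) →
      |α - (a : ℝ) / (q : ℝ)| ≤ 1 / (q : ℝ) ^ 2 →
      ‖moebiusExpSum k X α‖ ≤ C * (X ^ (seqA k + ε) + X * Real.log X ^ p / (q : ℝ) ^ b +
        X ^ c * (q : ℝ) ^ (1 - c) * Real.log X ^ p) := by
  obtain ⟨C₁, hC₁, hmain⟩ := exists_norm_moebiusExpSum_sq_le hk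
  obtain ⟨C₂, hC₂, hlogX⟩ := exists_one_add_log_pow_le ((k + 1) ^ 2 + 2)
    (show 0 < ε * 2 by linarith)
  refine ⟨3 * C₁ * C₂ * 3 ^ p, by positivity, fun X α a q hX hq ha hα => ?_⟩
  have hX0 : 0 < X := by linarith
  have hq0 : (0 : ℝ) < q := by exact_mod_cast hq
  have hq1 : (1 : ℝ) ≤ q := by exact_mod_cast hq
  set L := Real.log X with hL
  have hL0 : 0 ≤ L := Real.log_nonneg (by linarith)
  have hlL : 1 + L ≤ 3 * L := one_add_log_le hX
  have hlp : (1 + L) ^ p ≤ 3 ^ p * L ^ p := by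
    rw [← mul_pow]; gcongr
  set T₁ := X ^ (seqA k + ε) with hT₁
  set T₂ := X * L ^ p / (q : ℝ) ^ b with hT₂
  set T₃ := X ^ c * (q : ℝ) ^ (1 - c) * L ^ p with hT₃
  have hT₁0 : 0 ≤ T₁ := by positivity
  have hT₂0 : 0 ≤ T₂ := by positivity
  have hT₃0 : 0 ≤ T₃ := by positivity
  have hT₃eq : T₃ = X * L ^ p * ((q : ℝ) / X) ^ (1 - c) := by
    rw [hT₃, Real.div_rpow hq0.le hX0.le, show c = 1 - (1 - c) by ring, Real.rpow_sub hX0,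
      Real.rpow_one, sub_sub_cancel]
    ring
  have hT₂eq : T₂ = X * L ^ p * (1 / (q : ℝ)) ^ b := by
    rw [hT₂, one_div, Real.inv_rpow hq0.le]
    ring
  have htriv : ‖moebiusExpSum k X α‖ ≤ X * (1 + L) ^ (k - 1) :=
    norm_moebiusExpSum_le (by omega) (by linarith) α
  set S := ‖moebiusExpSum k X α‖ with hS
  have hS0 : 0 ≤ S := norm_nonneg _
  have h3p : (1 : ℝ) ≤ 3 ^ p := one_le_pow₀ (by norm_num)
  have hC12 : 1 ≤ 3 * C₁ := by linarith
  have hfinish : ∀ T : ℝ, T ≤ T₁ + T₂ + T₃ → S ≤ 3 * C₁ * C₂ * 3 ^ p * T →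
      S ≤ 3 * C₁ * C₂ * 3 ^ p * (T₁ + T₂ + T₃) := fun T hT h =>
    h.trans (mul_le_mul_of_nonneg_left hT (by positivity))
  have hscale : ∀ W : ℝ, 0 ≤ W → S ≤ 3 * C₁ * (X * (1 + L) ^ p * W) →
      S ≤ 3 * C₁ * C₂ * 3 ^ p * (X * L ^ p * W) := by
    intro W hW h
    calc S ≤ 3 * C₁ * (X * (1 + L) ^ p * W) := h
      _ ≤ 3 * C₁ * (X * (3 ^ p * L ^ p) * W) := by gcongr
      _ = 3 * C₁ * 1 * 3 ^ p * (X * L ^ p * W) := by ring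
      _ ≤ _ := by gcongr
  -- For `q ≤ X` the largest of the three terms of the mean square bound decides which term of the
  -- claim is used; for `q > X` the third term of the claim exceeds the trivial bound.
  rcases le_or_gt (q : ℝ) X with hqX | hqX
  · have hsq := hmain X α a q (by linarith) hq ha hα hqX
    rw [← hL, ← hS] at hsq
    set E := (k + 1) ^ 2 + 2
    set Y₁ := (X ^ seqA k) ^ 2
    set Y₂ := X ^ 2 * (1 / (q : ℝ))
    set Y₃ := X ^ 2 * ((q : ℝ) / X)
    have hY : ∀ Y : ℝ, Y₂ + Y₃ + Y₁ ≤ 3 * Y → S ^ 2 ≤ 3 * C₁ * (1 + L) ^ E * Y := by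
      intro Y hY
      refine hsq.trans ?_
      calc C₁ * (1 + L) ^ E * (Y₂ + Y₃ + Y₁) ≤ C₁ * (1 + L) ^ E * (3 * Y) := by gcongr
        _ = _ := by ring
    by_cases h1 : Y₂ ≤ Y₁ ∧ Y₃ ≤ Y₁
    · refine hfinish T₁ (by linarith) ?_
      have h2 := hY Y₁ (by linarith)
      refine (pow_le_pow_iff_left₀ hS0 (by positivity) two_ne_zero).1 (h2.trans ?_)
      calc 3 * C₁ * (1 + L) ^ E * Y₁ ≤ 3 * C₁ * (C₂ * X ^ (ε * 2)) * Y₁ := by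
            gcongr
            exact hlogX X (by linarith)
        _ = (3 * C₁ * C₂) * T₁ ^ 2 := by
            rw [hT₁, Real.rpow_add hX0, mul_pow, ← Real.rpow_mul_natCast hX0.le ε]
            push_cast
            ring
        _ ≤ (3 * C₁ * C₂ * 3 ^ p) ^ 2 * T₁ ^ 2 := by
            gcongr
            have h4 : 1 ≤ 3 * C₁ * C₂ := one_le_mul_of_one_le_of_one_le hC12 hC₂
            have h5 : 3 * C₁ * C₂ ≤ 3 * C₁ * C₂ * 3 ^ p := le_mul_of_one_le_right (by linarith) h3p
            exact h5.trans (le_self_pow₀ (h4.trans h5) two_ne_zero)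
        _ = _ := by ring
    by_cases h2 : Y₃ ≤ Y₂
    · have h12 : Y₁ ≤ Y₂ := by
        by_contra h
        exact h1 ⟨by linarith, by linarith⟩
      refine hfinish T₂ (by linarith) ?_
      rw [hT₂eq]
      refine hscale _ (by positivity) ?_
      refine le_mul_rpow_of_sq_le hS0 hX0.le (by linarith) (by positivity) ?_ hC12 htriv
        (hY Y₂ (by linarith)) hn₁ he₁ hb
      rw [div_le_one hq0]
      exact hq1
    · have h13 : Y₁ ≤ Y₃ := by
        by_contra h
        exact h1 ⟨by linarith, by linarith⟩
      refine hfinish T₃ (by linarith) ?_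
      rw [hT₃eq]
      refine hscale _ (by positivity) ?_
      refine le_mul_rpow_of_sq_le hS0 hX0.le (by linarith) (by positivity) ?_ hC12 htriv
        (hY Y₃ (by linarith)) hn₂ he₂ hc
      rw [div_le_one hX0]
      exact hqX
  · refine hfinish T₃ (by linarith) ?_
    rw [hT₃eq]
    refine hscale _ (by positivity) ?_
    have h1 : 1 ≤ ((q : ℝ) / X) ^ (1 - c) :=
      Real.one_le_rpow (by rw [le_div_iff₀ hX0]; linarith) hc0
    have h2 : (1 + L) ^ (k - 1) ≤ (1 + L) ^ p := pow_le_pow_right₀ (by linarith) hp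
    calc S ≤ X * (1 + L) ^ (k - 1) := htriv
      _ ≤ X * (1 + L) ^ p := by gcongr
      _ ≤ X * (1 + L) ^ p * ((q : ℝ) / X) ^ (1 - c) := le_mul_of_one_le_right (by positivity) h1
      _ ≤ _ := le_mul_of_one_le_left (by positivity) hC12

/-! ### Uniformity in `k` -/

lemma exists_exp_log_sq_le {δ : ℝ} (hδ : 0 < δ) :
    ∃ C : ℝ, 0 < C ∧ ∀ L : ℝ, 0 ≤ L → Real.exp (Real.log (1 + L) ^ 2) ≤ C * Real.exp (δ * L) := by
  refine ⟨Real.exp (δ + 64 / δ), Real.exp_pos _, fun L hL => ?_⟩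
  rw [← Real.exp_add, Real.exp_le_exp]
  set t := √(1 + L) with ht
  have ht2 : t ^ 2 = 1 + L := Real.sq_sqrt (by linarith)
  have ht0 : 0 ≤ t := Real.sqrt_nonneg _
  have hlog0 : 0 ≤ Real.log (1 + L) := Real.log_nonneg (by linarith)
  have hlog : Real.log (1 + L) ≤ 4 * √t := by
    have h1 : Real.log √t = Real.log (1 + L) / 4 := by
      rw [Real.log_sqrt ht0, ht, Real.log_sqrt (by linarith)]
      ring
    have h2 := Real.log_le_self (Real.sqrt_nonneg t)
    linarith
  have hsq : Real.log (1 + L) ^ 2 ≤ 16 * t := by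
    calc Real.log (1 + L) ^ 2 ≤ (4 * √t) ^ 2 := by gcongr
      _ = 16 * t := by rw [mul_pow, Real.sq_sqrt ht0]; norm_num
  have hamgm : 16 * t ≤ δ * t ^ 2 + 64 / δ := by
    have h : δ * t ^ 2 + 64 / δ - 16 * t = (δ * t - 8) ^ 2 / δ := by
      field_simp
      ring
    have h' : 0 ≤ (δ * t - 8) ^ 2 / δ := by positivity
    linarith
  rw [ht2] at hamgm
  linarith

/-- For `k` large in terms of `ε` the trivial bound is good enough, uniformly in `k`.  If
`X ^ b_k` is at most the gain `log X ^ (k² - 9 (k - 1))`, then the second term on the right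
exceeds the trivial bound; otherwise `log X > 3 ^ (k - 1)`, so that the trivial bound is at most
`X ^ (1 + ε / 2)`. -/
lemma exists_uniform_of_large {ε : ℝ} (hε : 0 < ε) : ∃ K : ℕ, ∃ C : ℝ, 0 < C ∧
    ∀ k : ℕ, K ≤ k → ∀ (X α : ℝ) (q : ℕ), 3 ≤ X → 0 < q →
      ‖moebiusExpSum k X α‖ ≤
        C * (X ^ (seqA k + ε) + X * Real.log X ^ (k ^ 2) / (q : ℝ) ^ (seqB k) +
          X ^ (seqC k) * (q : ℝ) ^ (1 - seqC k) * Real.log X ^ (k ^ 2)) := by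
  obtain ⟨C, hC, hexp⟩ := exists_exp_log_sq_le (half_pos hε)
  obtain ⟨K₀, hK₀⟩ := exists_nat_gt (2 / ε)
  refine ⟨max K₀ 10, C + 1, by linarith, fun k hk X α q hX hq => ?_⟩
  have hk10 : 10 ≤ k := (le_max_right _ _).trans hk
  have hX0 : 0 < X := by linarith
  have hq0 : (0 : ℝ) < q := by exact_mod_cast hq
  have htriv := norm_moebiusExpSum_le (show 1 ≤ k by omega) (show 1 ≤ X by linarith) α
  set L := Real.log X with hL
  have hL1 : 1.0986 ≤ L := by
    have h1 := Real.log_le_log (by norm_num) hX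
    have h2 := Real.log_three_gt_d9
    linarith
  have hL0 : 0 ≤ L := by linarith
  -- as `log 3 > 1`, a fixed power of `log X` dominates `1 + log X` for all `X ≥ 3`
  have hL8 : 2 ≤ L ^ 8 := by
    calc (2 : ℝ) ≤ 1.0986 ^ 8 := by norm_num
      _ ≤ L ^ 8 := by gcongr
  have hlL : 1 + L ≤ L ^ 9 := by
    calc 1 + L ≤ 2 * L := by linarith
      _ ≤ L ^ 8 * L := by gcongr
      _ = L ^ 9 := by ring
  have hlk : (1 + L) ^ (k - 1) ≤ L ^ (9 * (k - 1)) := by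
    rw [pow_mul]; gcongr
  obtain ⟨d, hd⟩ : ∃ d, k ^ 2 = 9 * (k - 1) + 16 + d := by
    obtain ⟨i, rfl⟩ : ∃ i, k = i + 10 := ⟨k - 10, by omega⟩
    exact ⟨i * i + 11 * i + 3, by rw [show i + 10 - 1 = i + 9 by omega]; ring⟩
  have hB := seqB_mem (show 1 ≤ k by omega)
  have hCk := seqC_mem (show 1 ≤ k by omega)
  have hlogk : (1 + L) ^ (k - 1) ≤ L ^ (k ^ 2) :=
    hlk.trans (pow_le_pow_right₀ (by linarith) (by omega))
  set T₁ := X ^ (seqA k + ε) with hT₁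
  set T₂ := X * L ^ (k ^ 2) / (q : ℝ) ^ (seqB k) with hT₂
  set T₃ := X ^ (seqC k) * (q : ℝ) ^ (1 - seqC k) * L ^ (k ^ 2) with hT₃
  have hT₁0 : 0 ≤ T₁ := by positivity
  have hT₂0 : 0 ≤ T₂ := by positivity
  have hT₃0 : 0 ≤ T₃ := by positivity
  have hfinish : ∀ c T : ℝ, 0 ≤ c → c ≤ C + 1 → 0 ≤ T → T ≤ T₁ + T₂ + T₃ →
      X * (1 + L) ^ (k - 1) ≤ c * T →
      ‖moebiusExpSum k X α‖ ≤ (C + 1) * (T₁ + T₂ + T₃) := fun c T hc hcC hT hTs h =>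
    htriv.trans (h.trans (mul_le_mul hcC hTs hT (by linarith)))
  rcases le_or_gt X q with hqX | hqX
  · refine hfinish 1 T₃ zero_le_one (by linarith) hT₃0 (by linarith) ?_
    rw [one_mul, hT₃]
    have h1 : X ≤ X ^ (seqC k) * (q : ℝ) ^ (1 - seqC k) := by
      calc X = X ^ (seqC k) * X ^ (1 - seqC k) := by
            rw [← Real.rpow_add hX0, add_sub_cancel, Real.rpow_one]
        _ ≤ _ := by gcongr; exact hCk.1
    gcongr
  have hqb : (q : ℝ) ^ (seqB k) ≤ X ^ (seqB k) := by gcongr; exact hB.1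
  by_cases hcase : X ^ (seqB k) ≤ L ^ (16 + d)
  · refine hfinish 1 T₂ zero_le_one (by linarith) hT₂0 (by linarith) ?_
    rw [one_mul, hT₂, le_div_iff₀ (by positivity), mul_assoc]
    gcongr
    calc (1 + L) ^ (k - 1) * (q : ℝ) ^ (seqB k) ≤ L ^ (9 * (k - 1)) * L ^ (16 + d) := by
          gcongr
          exact hqb.trans hcase
      _ = L ^ (k ^ 2) := by rw [← pow_add, hd, add_assoc]
  · refine hfinish C T₁ hC.le (by linarith) hT₁0 (by linarith) ?_
    obtain ⟨m, rfl⟩ : ∃ m, k = m + 1 := ⟨k - 1, by omega⟩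
    rw [Nat.add_sub_cancel]
    have hbL : 1 < seqB (m + 1) * L := by
      rw [← Real.exp_lt_exp, mul_comm, hL, ← Real.rpow_def_of_pos hX0]
      refine lt_of_lt_of_le ?_ (not_le.1 hcase).le
      calc Real.exp 1 < 2 ^ 2 := by linarith [Real.exp_one_lt_d9]
        _ ≤ (L ^ 8) ^ 2 := by gcongr
        _ = L ^ 16 := by ring
        _ ≤ L ^ (16 + d) := pow_le_pow_right₀ (by linarith) (by omega)
    have hmL : (m : ℝ) ≤ Real.log (1 + L) := by
      rw [Real.le_log_iff_exp_le (by linarith)]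
      rw [seqB_succ_eq, one_div_mul_eq_div, lt_div_iff₀ (by positivity)] at hbL
      have h3 : Real.exp m ≤ 3 ^ m := by
        rw [← Real.exp_one_pow]
        gcongr
        linarith [Real.exp_one_lt_d9]
      have h4 : (0 : ℝ) < 3 ^ m := by positivity
      linarith
    have hA : 1 + ε / 2 ≤ seqA (m + 1) + ε := by
      rw [seqA_succ_eq]
      have hb := one_add_mul_le_pow (a := (2 : ℝ)) (by norm_num) (m + 1)
      norm_num at hb
      have hmK : (K₀ : ℝ) ≤ m + 1 := by exact_mod_cast (le_max_left _ _).trans hk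
      have h5 : 2 / ε ≤ 2 * 3 ^ (m + 1) - 1 := by linarith
      have h6 : 1 / (2 * 3 ^ (m + 1) - 1 : ℝ) ≤ 1 / (2 / ε) :=
        one_div_le_one_div_of_le (by positivity) h5
      rw [one_div_div] at h6
      linarith
    calc X * (1 + L) ^ m = X * Real.exp (Real.log (1 + L) * m) := by
          rw [← Real.rpow_def_of_pos (by linarith), Real.rpow_natCast]
      _ ≤ X * Real.exp (Real.log (1 + L) ^ 2) := by
          rw [sq]
          have : 0 ≤ Real.log (1 + L) := Real.log_nonneg (by linarith)
          gcongr
      _ ≤ X * (C * Real.exp (ε / 2 * L)) := by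
          gcongr
          exact hexp L hL0
      _ = C * X ^ (1 + ε / 2) := by
          rw [Real.rpow_add hX0, Real.rpow_one, mul_comm (ε / 2), hL, ← Real.rpow_def_of_pos hX0]
          ring
      _ ≤ C * T₁ := by
          rw [hT₁]
          gcongr
          linarith

/-- For `k = 2` the weights `2 / 6` and `2 / 8` give the exponents `1 / 6` and `1 / 8` with powers
`15 / 6` and `17 / 8` of the logarithm. -/
lemma exists_norm_moebiusExpSum_two_le {ε : ℝ} (hε : 0 < ε) : ∃ C : ℝ, 0 < C ∧
    ∀ (X α : ℝ) (a : ℤ) (q : ℕ), 2 ≤ X → 0 < q → IsCoprime a (q : ℤ) →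
      |α - (a : ℝ) / (q : ℝ)| ≤ 1 / (q : ℝ) ^ 2 →
      ‖moebiusExpSum 2 X α‖ ≤ C * (X ^ (seqA 2 + ε) +
        X * Real.log X ^ 3 / (q : ℝ) ^ ((1 : ℝ) / 6) +
        X ^ ((7 : ℝ) / 8) * (q : ℝ) ^ (1 - (7 : ℝ) / 8) * Real.log X ^ 3) :=
  exists_norm_moebiusExpSum_le le_rfl (n₁ := 6) (n₂ := 8) (by norm_num) (by norm_num)
    (by norm_num) (by norm_num) (by norm_num) (by norm_num) (by norm_num) (by norm_num) hε

lemma exists_norm_moebiusExpSum_le_seq {k : ℕ} (hk : 2 ≤ k) {ε : ℝ} (hε : 0 < ε) :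
    ∃ C : ℝ, 0 < C ∧ ∀ (X α : ℝ) (a : ℤ) (q : ℕ), 2 ≤ X → 0 < q → IsCoprime a (q : ℤ) →
      |α - (a : ℝ) / (q : ℝ)| ≤ 1 / (q : ℝ) ^ 2 →
      ‖moebiusExpSum k X α‖ ≤
        C * (X ^ (seqA k + ε) + X * Real.log X ^ (k ^ 2) / (q : ℝ) ^ (seqB k) +
          X ^ (seqC k) * (q : ℝ) ^ (1 - seqC k) * Real.log X ^ (k ^ 2)) := by
  rcases hk.eq_or_lt with rfl | hk3
  · have hb : seqB 2 = 1 / 6 := by norm_num [seqB]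
    have hc : seqC 2 = 7 / 8 := by norm_num [seqC]
    rw [hb, hc]
    exact exists_norm_moebiusExpSum_le le_rfl (n₁ := 6) (n₂ := 8) (by norm_num) (by norm_num)
      (by norm_num) (by norm_num) (by norm_num) (by norm_num) (by norm_num) (by norm_num) hε
  · have hB := seqB_mem (show 1 ≤ k by omega)
    have hC := seqC_mem (show 1 ≤ k by omega)
    -- no interpolation is needed: `((k + 1)² + 2) / 2 ≤ k²` for `k ≥ 3`
    have hE : (2 - 2) * (k - 1) + ((k + 1) ^ 2 + 2) ≤ k ^ 2 * 2 := by
      rw [Nat.sub_self, zero_mul, zero_add]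
      nlinarith
    exact exists_norm_moebiusExpSum_le hk (n₁ := 2) (n₂ := 2)
      ((Nat.sub_le _ _).trans (Nat.le_self_pow two_ne_zero k)) le_rfl le_rfl
      hE hE (by exact_mod_cast hB.2) hC.1 (by exact_mod_cast hC.2) hε

end

theorem theorem1p5 :
    -- the implied constant depends on `ε` only, uniformly in `k`, for `X ≥ 3`
    (∀ ε : ℝ, 0 < ε → ∃ C : ℝ, 0 < C ∧ ∀ k : ℕ, 2 ≤ k →
      ∀ (X α : ℝ) (a : ℤ) (q : ℕ), 3 ≤ X → 0 < q → IsCoprime a (q : ℤ) →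
        |α - (a : ℝ) / (q : ℝ)| ≤ 1 / (q : ℝ) ^ 2 →
        ‖moebiusExpSum k X α‖ ≤
          C * (X ^ (seqA k + ε)
            + X * Real.log X ^ (k ^ 2) / (q : ℝ) ^ (seqB k)
            + X ^ (seqC k) * (q : ℝ) ^ (1 - seqC k) * Real.log X ^ (k ^ 2))) ∧
    -- the full range `X ≥ 2`, for each fixed `k`
    (∀ ε : ℝ, 0 < ε → ∀ k : ℕ, 2 ≤ k → ∃ C : ℝ, 0 < C ∧
      ∀ (X α : ℝ) (a : ℤ) (q : ℕ), 2 ≤ X → 0 < q → IsCoprime a (q : ℤ) →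
        |α - (a : ℝ) / (q : ℝ)| ≤ 1 / (q : ℝ) ^ 2 →
        ‖moebiusExpSum k X α‖ ≤
          C * (X ^ (seqA k + ε)
            + X * Real.log X ^ (k ^ 2) / (q : ℝ) ^ (seqB k)
            + X ^ (seqC k) * (q : ℝ) ^ (1 - seqC k) * Real.log X ^ (k ^ 2))) ∧
    -- the case `k = 2`, with the third power of the logarithm
    (∀ ε : ℝ, 0 < ε → ∃ C : ℝ, 0 < C ∧
      ∀ (X α : ℝ) (a : ℤ) (q : ℕ), 2 ≤ X → 0 < q → IsCoprime a (q : ℤ) →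
        |α - (a : ℝ) / (q : ℝ)| ≤ 1 / (q : ℝ) ^ 2 →
        ‖moebiusExpSum 2 X α‖ ≤
          C * (X ^ ((16 : ℝ) / 17 + ε)
            + (X / (q : ℝ) ^ ((1 : ℝ) / 6)
              + X ^ ((7 : ℝ) / 8) * (q : ℝ) ^ ((1 : ℝ) / 8)) * Real.log X ^ 3)) := by
  refine ⟨fun ε hε => ?_, fun ε hε k hk => exists_norm_moebiusExpSum_le_seq hk hε,
    fun ε hε => ?_⟩
  · obtain ⟨K, C, hC, hlarge⟩ := exists_uniform_of_large hε
    choose! C' hC' hsmall using fun (k : ℕ) (hk : 2 ≤ k) => exists_norm_moebiusExpSum_le_seq hk hε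
    refine ⟨C + ∑ k ∈ Finset.range K, |C' k|,
      add_pos_of_pos_of_nonneg hC (Finset.sum_nonneg fun _ _ => abs_nonneg _),
      fun k hk X α a q hX hq ha hα => ?_⟩
    have hlog : 0 ≤ Real.log X := Real.log_nonneg (by linarith)
    rcases le_or_gt K k with hKk | hKk
    · refine (hlarge k hKk X α q hX hq).trans (mul_le_mul_of_nonneg_right ?_ (by positivity))
      linarith [Finset.sum_nonneg fun (k : ℕ) (_ : k ∈ Finset.range K) => abs_nonneg (C' k)]
    · refine (hsmall k hk X α a q (by linarith) hq ha hα).trans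
        (mul_le_mul_of_nonneg_right ?_ (by positivity))
      have h1 := Finset.single_le_sum (f := fun k => |C' k|) (fun _ _ => abs_nonneg _) (Finset.mem_range.2 hKk)
      have h2 := le_abs_self (C' k)
      linarith
  · obtain ⟨C, hC, h⟩ := exists_norm_moebiusExpSum_two_le hε
    refine ⟨C, hC, fun X α a q hX hq ha hα => (h X α a q hX hq ha hα).trans (le_of_eq ?_)⟩
    rw [show seqA 2 = 16 / 17 by norm_num [seqA], show (1 : ℝ) - 7 / 8 = 1 / 8 by norm_num]
    ring
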